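/- **Generalized Cops and Robber.** An instance consists of a finite connected graph $G$ with at least one vertex, a list of $k\ge 0$ cops $\mathcal C_1,\dots,\mathcal C_k$ and a robber $\mathcal R$. Cop $\mathcal C_i$ has a speed $s_i\ge 1$, a reach $\lambda_i\ge 0$ and a status (active, lazy or flexible); the robber has a speed $s_R\ge 0$ and a status; active agents have speed $1$. A vertex is *safe* if, for every $i$, its distance to $\mathcal C_i$ is greater than $\lambda_i$. First the cops are placed on vertices, then the robber is placed on a safe vertex (if there is none, the cops win); then the two sides move alternately, starting with the cops. In a cop move each cop $\mathcal C_i$ moves along at most $s_i$ edges, every active cop has to change its vertex, and at most one lazy cop does so. In a robber move the robber moves along a path with at most $s_R$ edges all of whose vertices are safe, and an active robber has to change its vertex (a robber that is not active may move or stay). The cops win if at the end of some cop move the robber is on a vertex that is not safe, or if the robber has no legal move. The instance is a Yes-instance if the cops have a winning strategy. Let $\mathsf{vcn}$ be the minimum size of a vertex cover of $G$. An instance is encoded by its adjacency matrix and the list of its numbers and statuses, numbers being measured by their binary length. **Theorem.** (1) Generalized Cops and Robber parameterized by $\mathsf{vcn}$ admits a kernel with at most $\mathsf{vcn}+\mathsf{vcn}\cdot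 2^{\mathsf{vcn}}$ vertices. That is, there is a polynomial-time algorithm that maps every instance to an equivalent instance of the same problem (one is a Yes-instance if and only if the other is) whose graph has at most $\max\{1,\ \mathsf{vcn}+\mathsf{vcn}\cdot 2^{\mathsf{vcn}}\}$ vertices and whose encoding length is at most $g(\mathsf{vcn})$, where $g$ is a computable function and $\mathsf{vcn}$ refers to the input graph. (The maximum with $1$ matters only for the one-vertex graph, where $\mathsf{vcn}=0$.) (2) The following reduction rule is safe. Let $U$ be a vertex cover of $G$, let $S\subseteq U$, and let $\mathcal C_S=\{v\in V(G)\setminus U : N(v)=S\}$. If $|\mathcal C_S|>k+1$, then keeping any $k+1$ vertices of $\mathcal C_S$ and deleting the others leaves a connected graph, and the instance with this graph and the same cops and robber is a Yes-instance if and only if the original one is. -/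

import Mathlib

/-! ### Random access machines

A structured programming language for the unit-cost RAM: finitely many named registers and finitely
many named arrays, all holding natural numbers. The only arithmetic operations are addition and
truncated subtraction (no multiplication), so that unit cost is polynomially equivalent to
Turing machine time. -/

namespace RAM

/-- Memory: registers `reg x` and arrays `arr a`, with cells `arr a i`. -/
structure Memory where
  reg : ℕ → ℕ
  arr : ℕ → ℕ → ℕ

/-- Expressions. -/
inductive Term where
  | const (c : ℕ)
  | reg (x : ℕ)
  | get (a : ℕ) (index : Term)
  | add (e f : Term)
  | sub (e f : Term)

/-- Value of an expression. -/
def Term.eval (m : Memory) : Term → ℕ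
  | .const c => c
  | .reg x => m.reg x
  | .get a e => m.arr a (e.eval m)
  | .add e f => e.eval m + f.eval m
  | .sub e f => e.eval m - f.eval m

/-- Number of steps needed to evaluate an expression: one for each node. -/
def Term.cost : Term → ℕ
  | .const _ => 1
  | .reg _ => 1
  | .get _ e => e.cost + 1
  | .add e f => e.cost + f.cost + 1
  | .sub e f => e.cost + f.cost + 1

/-- Programs. A test succeeds when its value is not `0`. -/
inductive Prog where
  | skip
  | assign (x : ℕ) (e : Term)
  | write (a : ℕ) (index e : Term)
  | seq (p q : Prog)
  | cond (e : Term) (p q : Prog)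
  | loop (e : Term) (p : Prog)

/-- `m.setReg x v` is `m` with register `x` set to `v`. -/
def Memory.setReg (m : Memory) (x v : ℕ) : Memory :=
  { m with reg := Function.update m.reg x v }

/-- `m.setArr a i v` is `m` with cell `i` of array `a` set to `v`. -/
def Memory.setArr (m : Memory) (a i v : ℕ) : Memory :=
  { m with arr := Function.update m.arr a (Function.update (m.arr a) i v) }

/-- `Exec p m t m'`: program `p`, started in memory `m`, halts after `t` steps in memory `m'`. -/
inductive Exec : Prog → Memory → ℕ → Memory → Prop where
  | skip (m) : Exec .skip m 1 m
  | assign (m x e) : Exec (.assign x e) m (e.cost + 1) (m.setReg x (e.eval m))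
  | write (m a i e) :
      Exec (.write a i e) m (i.cost + e.cost + 1) (m.setArr a (i.eval m) (e.eval m))
  | seq {p q m t m' t' m''} : Exec p m t m' → Exec q m' t' m'' → Exec (.seq p q) m (t + t') m''
  | cond_true {e p q m t m'} : e.eval m ≠ 0 → Exec p m t m' →
      Exec (.cond e p q) m (e.cost + 1 + t) m'
  | cond_false {e p q m t m'} : e.eval m = 0 → Exec q m t m' →
      Exec (.cond e p q) m (e.cost + 1 + t) m'
  | loop_done {e p m} : e.eval m = 0 → Exec (.loop e p) m (e.cost + 1) m
  | loop_step {e p m t m' t' m''} : e.eval m ≠ 0 → Exec p m t m' → Exec (.loop e p) m' t' m'' →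
      Exec (.loop e p) m (e.cost + 1 + t + t') m''

/-- The memory at the start: the input list is in array `0`, its length is in register `0`, and
everything else is `0`. -/
def start (l : List ℕ) : Memory where
  reg x := if x = 0 then l.length else 0
  arr a i := if a = 0 then l.getD i 0 else 0

/-- The list `l` is the output: it is in array `0` and its length is in register `0`. -/
def Output (m : Memory) (l : List ℕ) : Prop :=
  m.reg 0 = l.length ∧ ∀ i (h : i < l.length), m.arr 0 i = l[i]

/-- Size of a list of natural numbers: the number of binary digits, plus one separator for each
entry. -/
def bitSize (l : List ℕ) : ℕ :=
  (l.map fun a => Nat.size a + 1).sum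

/-- `f`, seen through the encoding `enc`, is computed by one RAM program in a number of steps that
is at most a polynomial in the bit size of the input. -/
def PolyTimeComputable {α : Type*} (enc : α → List ℕ) (f : α → α) : Prop :=
  ∃ (p : Prog) (q : Polynomial ℕ), ∀ x : α, ∃ (t : ℕ) (m : Memory),
    Exec p (start (enc x)) t m ∧ t ≤ q.eval (bitSize (enc x)) ∧ Output m (enc (f x))

end RAM

/-! ### The generalized game of cops and robber -/

namespace CnR

/-- Movement status of an agent. -/
inductive Status where
  | active
  | lazy
  | flexible

/-- The capabilities of a cop. Being active is a notion for agents of speed one. -/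
structure Cop where
  speed : ℕ
  reach : ℕ
  status : Status
  speed_pos : 1 ≤ speed
  speed_of_active : status = .active → speed = 1

/-- The capabilities of the robber. -/
structure Robber where
  speed : ℕ
  status : Status
  speed_of_active : status = .active → speed = 1

section Game

variable {V : Type*} (G : SimpleGraph V) {k : ℕ} (cop : Fin k → Cop) (R : Robber)

/-- The vertices `u` and `v` are at distance at most `d` in `G`. -/
def DistLE (u v : V) (d : ℕ) : Prop :=
  ∃ p : G.Walk u v, p.length ≤ d

/-- With the cops at the vertices `c i`, the vertex `v` is out of the reach of every cop. -/
def Safe (c : Fin k → V) (v : V) : Prop :=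
  ∀ i, ¬ DistLE G (c i) v (cop i).reach

/-- A legal cop move, from the placement `c` to the placement `c'`: every cop moves along at most
as many edges as its speed, every active cop moves, and at most one lazy cop moves. -/
def CopMove (c c' : Fin k → V) : Prop :=
  (∀ i, DistLE G (c i) (c' i) (cop i).speed) ∧
  (∀ i, (cop i).status = .active → c' i ≠ c i) ∧
  (∀ i j, (cop i).status = .lazy → (cop j).status = .lazy → c' i ≠ c i → c' j ≠ c j → i = j)

/-- A legal robber move from `r` to `r'`, with the cops at `c`: along a path of at most as many
edges as the robber's speed, all of whose vertices are out of the reach of the cops; an active robber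
has to move. (A lazy robber may move or stay, since it is the only robber.) -/
def RobberMove (c : Fin k → V) (r r' : V) : Prop :=
  (∃ p : G.Walk r r', p.IsPath ∧ p.length ≤ R.speed ∧ ∀ v ∈ p.support, Safe G cop c v) ∧
  (R.status = .active → r' ≠ r)

/-- `CopsWinFrom G cop R c r`: the cops have a winning strategy from the position in which the cops
are at `c`, the robber is at `r`, and it is the cops' turn. They win if after some cop move the
robber is in the reach of a cop, or if they have a move after which they win whatever legal move
the robber makes. (A robber without a legal move has lost.) -/
inductive CopsWinFrom : (Fin k → V) → V → Prop where
  | capture {c c' : Fin k → V} {r : V} : CopMove G cop c c' → ¬ Safe G cop c' r → CopsWinFrom c r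
  | step {c c' : Fin k → V} {r : V} : CopMove G cop c c' →
      (∀ r', RobberMove G cop R c' r r' → CopsWinFrom c' r') → CopsWinFrom c r

/-- The cops have a winning strategy: they can be placed in such a way that they win from every
vertex out of their reach at which the robber may then be placed. -/
def CopsWin : Prop :=
  ∃ c : Fin k → V, ∀ r, Safe G cop c r → CopsWinFrom G cop R c r

end Game

/-- An instance of the generalized game: a finite connected nonempty graph, a list of cops with
their capabilities, and the robber with its capabilities. -/
structure Instance where
  n : ℕ
  graph : SimpleGraph (Fin n)
  connected : graph.Connected
  k : ℕ
  cop : Fin k → Cop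
  robber : Robber

namespace Instance

/-- The yes-instances are those in which the cops have a winning strategy. -/
def Yes (I : Instance) : Prop :=
  CopsWin I.graph I.cop I.robber

/-- The parameter: the minimum size of a vertex cover. -/
noncomputable def vcn (I : Instance) : ℕ :=
  I.graph.vertexCoverNum.toNat

/-- A number for each status. -/
def statusCode : Status → ℕ
  | .active => 0
  | .lazy => 1
  | .flexible => 2

open Classical in
/-- Instances as inputs of a machine: the number of vertices, the adjacency matrix row by row, the
number of cops, the speed, reach and status of each cop, and the speed and status of the
robber. -/
noncomputable def encode (I : Instance) : List ℕ :=
  [I.n] ++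
  ((List.finRange I.n).flatMap fun u => (List.finRange I.n).map fun v =>
    if I.graph.Adj u v then 1 else 0) ++
  [I.k] ++
  ((List.finRange I.k).flatMap fun i =>
    [(I.cop i).speed, (I.cop i).reach, statusCode (I.cop i).status]) ++
  [I.robber.speed, statusCode I.robber.status]

/-- For a set `U` of vertices and `S ⊆ U`, the class of the vertices outside `U` whose neighbourhood
is `S`. -/
def nbhdClass (I : Instance) (U S : Set (Fin I.n)) : Set (Fin I.n) :=
  {v | v ∉ U ∧ I.graph.neighborSet v = S}

/-- The graph that remains when the vertices of a class `C` that are not in `K` are deleted. -/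
abbrev keepOnly (I : Instance) (C K : Set (Fin I.n)) :
    SimpleGraph ↥{v : Fin I.n | v ∈ C → v ∈ K} :=
  I.graph.induce {v : Fin I.n | v ∈ C → v ∈ K}

end Instance

end CnR

/-! ### The game under graph homomorphisms. -/

namespace CnR

section Game

variable {V W : Type*} {G : SimpleGraph V} {H : SimpleGraph W} {k : ℕ} {cop : Fin k → Cop}
  {R : Robber}

/-! Everything rests on twins (vertices with equal neighbourhoods) and on the fact that
homomorphisms do not increase distances. Let `H` be an induced subgraph of `G` such that every
deleted vertex has more than `k` twins in `H` (`TwinRich`). Sending deleted vertices to twins is a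
retraction of `G` onto `H`, so `H` is connected and a cop strategy on `G` projects to one on `H`
(`CopsWin.of_retract`). Conversely, cops who win on `H` play the same moves inside `G` against a
shadow of the robber: a robber on a deleted vertex is represented by a twin in `H` that carries no
cop, which exists because `k` cops cannot occupy more than `k` twins. Exchanging the robber's vertex
with its shadow fixes all cop positions, so capturing the shadow captures the robber, and a robber
move in `G` folds to a legal move of the shadow (`CopsWinFrom.of_twinRich`). This gives part (2),
where `k + 1` twins remain.

For the kernel, `k + 1` vertices of each twin class are kept. Outside a minimum vertex cover there
are at most `2 ^ vcn` classes, so the bound holds once `k < vcn`. If `1 ≤ k` and `vcn ≤ k`, the cops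
occupy a vertex cover and win at once. Deciding `vcn ≤ k` is too expensive in general, so the test
is only for `vcn ≤ min k (log₂ n)`, where at most `n` branches of a bounded search suffice. When it
fails because of the logarithm, `n < 2 ^ vcn` and the graph is already small (`not_easy_cases`).
Lowering speeds and reaches to the number of vertices changes nothing, since shortest walks are
paths, and bounds the encoding length.

Polynomial time is shown by a small program logic (`Runs`): the time bound is read off the syntax of
a program, provided that no loop is repeated more often than the bit size of the input. Loop
invariants then show that the program writes exactly the encoding of `kernel`. -/

theorem DistLE.refl (G : SimpleGraph V) (v : V) (d : ℕ) : DistLE G v v d :=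
  ⟨.nil, by simp⟩

theorem DistLE.map (f : G →g H) {u v : V} {d : ℕ} (h : DistLE G u v d) :
    DistLE H (f u) (f v) d := by
  obtain ⟨p, hp⟩ := h
  exact ⟨p.map f, by simpa using hp⟩

theorem DistLE.adj {u v : V} (h : DistLE G u v 1) (hne : u ≠ v) : G.Adj u v := by
  obtain ⟨p, hp⟩ := h
  cases p with
  | nil => exact absurd rfl hne
  | cons hadj q =>
    cases q with
    | nil => exact hadj
    | cons _ _ => simp at hp

theorem distLE_of_adj {u v : V} {d : ℕ} (h : G.Adj u v) (hd : 1 ≤ d) : DistLE G u v d :=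
  ⟨h.toWalk, by simpa using hd⟩

/-- An active cop has speed one, so its move follows an edge; the image of an edge is an edge of a
loopless graph, hence the image of an active cop still changes its vertex. -/
theorem CopMove.map (f : G →g H) {c c' : Fin k → V} (h : CopMove G cop c c') :
    CopMove H cop (fun i => f (c i)) (fun i => f (c' i)) := by
  obtain ⟨h₁, h₂, h₃⟩ := h
  refine ⟨fun i => (h₁ i).map f, fun i hi => ?_, fun i j hi hj hci hcj => ?_⟩
  · have hd := h₁ i
    rw [(cop i).speed_of_active hi] at hd
    exact (f.map_adj (hd.adj (h₂ i hi).symm)).ne'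
  · exact h₃ i j hi hj (fun h => hci (by simp [h])) (fun h => hcj (by simp [h]))

theorem Safe.of_map (f : G →g H) {c : Fin k → V} {v : V}
    (h : Safe H cop (fun i => f (c i)) (f v)) : Safe G cop c v :=
  fun i hi => h i (hi.map f)

theorem Safe.ne {c : Fin k → V} {v : V} (h : Safe G cop c v) (i : Fin k) : c i ≠ v := by
  rintro rfl
  exact h i (.refl G _ _)

/-- The robber on `H` is copied into `G` by `e`, the winning cops play there, and their moves are
brought back by `ρ`. Since `ρ` does not increase distances, a vertex that is safe in `H` has a safe
copy in `G`, so every robber move on `H` is answered by the strategy on `G`. -/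
theorem CopsWinFrom.map_retract (e : H →g G) (ρ : G →g H) (hρ : ∀ w, ρ (e w) = w)
    {c : Fin k → V} {s : V} (h : CopsWinFrom G cop R c s) :
    ∀ r, s = e r → CopsWinFrom H cop R (fun i => ρ (c i)) r := by
  have safe {c : Fin k → V} {w : W} (hs : Safe H cop (fun i => ρ (c i)) w) :
      Safe G cop c (e w) := Safe.of_map ρ (by rwa [hρ])
  induction h with
  | capture hm hs =>
    rintro r rfl
    exact .capture (hm.map ρ) fun h => hs (safe h)
  | step hm _ ih =>
    rintro r rfl
    refine .step (hm.map ρ) ?_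
    rintro r' ⟨⟨p, hp, hl, hsafe⟩, hact⟩
    -- A section of `ρ` is injective, so it maps paths to paths and keeps an active robber moving.
    have einj : Function.Injective e := Function.LeftInverse.injective hρ
    refine ih (e r') ⟨⟨p.map e, hp.map einj, by simpa using hl, ?_⟩,
      fun h => einj.ne (hact h)⟩ r' rfl
    intro v hv
    rw [SimpleGraph.Walk.support_map, List.mem_map] at hv
    obtain ⟨w, hw, rfl⟩ := hv
    exact safe (hsafe w hw)

theorem CopsWin.of_retract (e : H →g G) (ρ : G →g H) (hρ : ∀ w, ρ (e w) = w)
    (h : CopsWin G cop R) : CopsWin H cop R := by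
  obtain ⟨c, hc⟩ := h
  refine ⟨fun i => ρ (c i), fun r hr => ?_⟩
  exact (hc (e r) (Safe.of_map ρ (by rwa [hρ]))).map_retract e ρ hρ r rfl

/-! ### Twins and the deletion of surplus twins. -/

/-- Twins are vertices with the same neighbourhood. -/
def Twins (G : SimpleGraph V) (u v : V) : Prop :=
  G.neighborSet u = G.neighborSet v

theorem Twins.adj_iff {u v w : V} (h : Twins G u v) : G.Adj u w ↔ G.Adj v w := by
  rw [← SimpleGraph.mem_neighborSet, h, SimpleGraph.mem_neighborSet]

theorem Twins.adj {u u' v v' : V} (hu : Twins G u' u) (hv : Twins G v' v) (h : G.Adj u v) :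
    G.Adj u' v' :=
  (hv.adj_iff.2 (hu.adj_iff.2 h).symm).symm

/-- A map that sends each vertex to a twin of its image in the larger graph is a homomorphism. -/
def foldHom (e : H ↪g G) (f : V → W) (hf : ∀ v, Twins G (e (f v)) v) : G →g H where
  toFun := f
  map_rel' {u v} h := e.map_rel_iff.1 ((hf u).adj (hf v) h)

open Classical in
/-- Exchanging two twins is an endomorphism. -/
noncomputable def swapHom {u v : V} (h : Twins G u v) : G →g G where
  toFun := Equiv.swap u v
  map_rel' {a b} hab := by
    have key (x : V) : Twins G (Equiv.swap u v x) x := by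
      rw [Equiv.swap_apply_def]
      split_ifs with h₁ h₂
      · rw [h₁]; exact h.symm
      · rw [h₂]; exact h
      · rfl
    exact (key a).adj (key b) hab

/-- Either `v` is the vertex `w` of the smaller graph, or it is a deleted vertex that is represented
by its twin `w`, which is not occupied by a cop. -/
def Represents (e : H ↪g G) (c : Fin k → W) (w : W) (v : V) : Prop :=
  e w = v ∨ (v ∉ Set.range e ∧ Twins G (e w) v ∧ ∀ i, c i ≠ w)

theorem Represents.twins {e : H ↪g G} {c : Fin k → W} {w : W} {v : V}
    (h : Represents e c w v) : Twins G (e w) v := by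
  obtain rfl | h := h
  · rfl
  · exact h.2.1

/-- Embed `H` and then exchange `e w` with its twin `v`. No cop stands on `w`, and `v` is outside
the range of `e`, so the exchange leaves all cops in place. -/
theorem Represents.exists_hom {e : H ↪g G} {c : Fin k → W} {w : W} {v : V}
    (h : Represents e c w v) : ∃ g : H →g G, (∀ i, g (c i) = e (c i)) ∧ g w = v := by
  classical
  obtain rfl | ⟨hv, ht, hw⟩ := h
  · exact ⟨e.toHom, fun _ => rfl, rfl⟩
  · refine ⟨(swapHom ht).comp e.toHom, fun i => ?_, Equiv.swap_apply_left _ _⟩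
    exact Equiv.swap_apply_of_ne_of_ne (e.injective.ne (hw i)) fun h => hv ⟨_, h⟩

theorem Represents.safe {e : H ↪g G} {c : Fin k → W} {w : W} {v : V}
    (h : Represents e c w v) (hs : Safe G cop (fun i => e (c i)) v) : Safe H cop c w := by
  obtain ⟨g, hg, rfl⟩ := h.exists_hom
  exact Safe.of_map g (by simpa only [hg] using hs)

/-- Every deleted vertex has more than `k` twins that are not deleted. -/
def TwinRich (e : H ↪g G) (k : ℕ) : Prop :=
  ∀ v ∉ Set.range e, k < {w | Twins G (e w) v}.ncard

/-- The cops occupy at most `k` vertices, so one of the more than `k` remaining twins is free. -/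
theorem TwinRich.exists_represents {e : H ↪g G} (he : TwinRich e k) (c : Fin k → W) (v : V) :
    ∃ w, Represents e c w v := by
  by_cases hv : v ∈ Set.range e
  · exact hv.imp fun w hw => .inl hw
  · have hc : (Set.range c).ncard ≤ k := by
      rw [← Set.image_univ]
      exact (Set.ncard_image_le Set.finite_univ).trans (by simp [Set.ncard_univ])
    obtain ⟨w, hw, hwc⟩ := Set.exists_mem_notMem_of_ncard_lt_ncard
      (hc.trans_lt (he v hv)) (Set.finite_range c)
    exact ⟨w, .inr ⟨hv, hw, fun i hi => hwc ⟨i, hi⟩⟩⟩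

/-- The representatives of all vertices can be chosen together, with a prescribed one for `v`. Any
such choice is a homomorphism because it only replaces vertices by twins. -/
theorem TwinRich.exists_fold {e : H ↪g G} (he : TwinRich e k) {c : Fin k → W} {w : W} {v : V}
    (h : Represents e c w v) :
    ∃ φ : G →g H, φ v = w ∧ ∀ u, Represents e c (φ u) u := by
  classical
  choose f hf using he.exists_represents c
  have hf' (u : V) : Represents e c (Function.update f v w u) u := by
    obtain rfl | hu := eq_or_ne u v
    · simpa using h
    · simpa [hu] using hf u
  exact ⟨foldHom e _ fun u => (hf' u).twins, by simp [foldHom], hf'⟩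

/-- The folded path may repeat vertices, so it is shortened to a path. Its vertices represent safe
vertices and are therefore safe. An active robber moves along one edge, whose image is again an
edge. -/
theorem RobberMove.fold {e : H ↪g G} {c : Fin k → W} {φ : G →g H} {r r' : V}
    (hφ : ∀ u, Represents e c (φ u) u)
    (h : RobberMove G cop R (fun i => e (c i)) r r') : RobberMove H cop R c (φ r) (φ r') := by
  classical
  obtain ⟨⟨p, hp, hl, hs⟩, hact⟩ := h
  refine ⟨⟨(p.map φ).bypass, SimpleGraph.Walk.bypass_isPath _, ?_, ?_⟩, fun ha => ?_⟩
  · exact (SimpleGraph.Walk.length_bypass_le_length _).trans (by simpa using hl)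
  · intro w hw
    have hw := SimpleGraph.Walk.support_bypass_subset_support _ hw
    rw [SimpleGraph.Walk.support_map, List.mem_map] at hw
    obtain ⟨v, hv, rfl⟩ := hw
    exact (hφ v).safe (hs v hv)
  · rw [R.speed_of_active ha] at hl
    exact (φ.map_adj (DistLE.adj ⟨p, hl⟩ (hact ha).symm)).ne'

/-- Induction on the strategy against the shadow `w` of the robber. In the capturing move the cops
are led by the homomorphism that sends `w` to `r`, so a cop that steps onto `w` steps onto `r` in
`G`. -/
theorem CopsWinFrom.of_twinRich {e : H ↪g G} (he : TwinRich e k) {c : Fin k → W} {w : W}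
    (h : CopsWinFrom H cop R c w) :
    ∀ r, Represents e c w r → CopsWinFrom G cop R (fun i => e (c i)) r := by
  have capture {c c' : Fin k → W} {w : W} {r : V} (hm : CopMove H cop c c')
      (hs : ¬ Safe H cop c' w) (hr : Represents e c w r) :
      CopsWinFrom G cop R (fun i => e (c i)) r := by
    obtain ⟨g, hg, rfl⟩ := hr.exists_hom
    simp only [← hg]
    exact .capture (hm.map g) fun h => hs (h.of_map g)
  induction h with
  | capture hm hs => exact fun r hr => capture hm hs hr
  | @step c c' w hm _ ih =>
    intro r hr
    by_cases hs : Safe H cop c' w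
    · have hr' : Represents e c' w r := hr.imp_right fun h => ⟨h.1, h.2.1, hs.ne⟩
      obtain ⟨φ, rfl, hφ⟩ := he.exists_fold hr'
      exact .step (hm.map e.toHom) fun r' hm' => ih _ (hm'.fold hφ) r' (hφ r')
    · exact capture hm hs hr

/-- The cops win on a graph if and only if they win after the deletion of vertices each of which
keeps more than `k` twins. -/
theorem TwinRich.copsWin_iff {e : H ↪g G} (he : TwinRich e k) [Nonempty W] :
    CopsWin G cop R ↔ CopsWin H cop R := by
  constructor
  · intro h
    obtain ⟨v₀⟩ : Nonempty V := ‹Nonempty W›.map e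
    choose f hf using fun v => he.exists_represents (k := k) (fun _ => Classical.arbitrary W) v
    refine h.of_retract e.toHom (foldHom e f fun v => (hf v).twins) fun w => ?_
    obtain h | h := hf (e w)
    · exact e.injective h
    · exact absurd ⟨w, rfl⟩ h.1
  · rintro ⟨c, hc⟩
    refine ⟨fun i => e (c i), fun r hr => ?_⟩
    obtain ⟨w, hw⟩ := he.exists_represents c r
    exact (hc w (hw.safe hr)).of_twinRich he r hw

theorem TwinRich.connected {e : H ↪g G} (he : TwinRich e k) [Nonempty W] (hG : G.Connected) :
    H.Connected := by
  choose f hf using fun v => he.exists_represents (k := k) (fun _ => Classical.arbitrary W) v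
  refine ⟨fun u v => ?_⟩
  have h := (hG.preconnected (e u) (e v)).map (foldHom e f fun v => (hf v).twins)
  have key (w : W) : f (e w) = w := (hf (e w)).elim (fun h => e.injective h)
    fun h => absurd ⟨w, rfl⟩ h.1
  simpa [foldHom, key] using h

/-! ### Cops on a vertex cover. -/

/-- Cops that can occupy a nonempty vertex cover win with their first move. -/
theorem copsWin_of_isVertexCover [Finite V] (hG : G.Connected) {U : Set V}
    (hU : G.IsVertexCover U) (hk : 1 ≤ k) (hUk : U.ncard ≤ k) : CopsWin G cop R := by
  classical
  obtain ⟨v₀⟩ := hG.nonempty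
  obtain ⟨c, hc⟩ : ∃ c : Fin k → V, U ⊆ Set.range c := by
    have : Fintype U := Fintype.ofFinite U
    have hcard : Fintype.card U ≤ Fintype.card (Fin k) := by
      rwa [Fintype.card_fin, ← Nat.card_eq_fintype_card, Nat.card_coe_set_eq]
    obtain ⟨g⟩ := Function.Embedding.nonempty_of_card_le hcard
    refine ⟨fun i => if h : ∃ u, g u = i then (h.choose : V) else v₀, fun u hu => ⟨g ⟨u, hu⟩, ?_⟩⟩
    have h : ∃ u', g u' = g ⟨u, hu⟩ := ⟨_, rfl⟩
    simp only [dif_pos h]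
    exact congrArg Subtype.val (g.injective h.choose_spec)
  refine ⟨c, fun r hr => ?_⟩
  -- There is a cop and a vertex without a cop, so the connected graph has two vertices and each
  -- vertex has a neighbour.
  have : Nontrivial V := ⟨c ⟨0, hk⟩, r, hr.ne _⟩
  choose nb hnb using hG.preconnected.exists_adj_of_nontrivial
  have hrU : r ∉ U := fun h => by
    obtain ⟨i, hi⟩ := hc h
    exact hr.ne i hi
  obtain ⟨i, hi⟩ := hc ((hU (hnb r)).resolve_left hrU)
  have hadj : G.Adj (c i) r := hi ▸ (hnb r).symm
  -- Every neighbour of `r` lies in `U` and carries a cop. Cop `i` captures from there; the other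
  -- active cops have to move and go to arbitrary neighbours, and all remaining cops stay, so at
  -- most one lazy cop moves.
  refine .capture (c' := Function.update
    (fun j => if (cop j).status = .active then nb (c j) else c j) i r) ⟨?_, ?_, ?_⟩ ?_
  · intro j
    obtain rfl | hj := eq_or_ne j i
    · simpa using distLE_of_adj hadj (cop j).speed_pos
    · simp only [Function.update_of_ne hj]
      split_ifs
      · exact distLE_of_adj (hnb _) (cop j).speed_pos
      · exact .refl _ _ _
  · intro j hact
    obtain rfl | hj := eq_or_ne j i
    · simpa using hadj.ne'
    · simpa [Function.update_of_ne hj, hact] using (hnb (c j)).ne'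
  · have key (j : Fin k) (hl : (cop j).status = .lazy) (hne : Function.update
        (fun j => if (cop j).status = .active then nb (c j) else c j) i r j ≠ c j) : j = i := by
      by_contra hj
      simp [Function.update_of_ne hj, hl] at hne
    intro j j' hj hj' h h'
    rw [key j hj h, key j' hj' h']
  · exact fun h => h.ne i (by simp)

/-! ### Lowering speeds and reaches to the number of vertices. -/

/-- A walk can be shortened to a path, and a path has fewer edges than the graph has vertices. -/
theorem distLE_min [Fintype V] {u v : V} {d : ℕ} :
    DistLE G u v (min d (Fintype.card V)) ↔ DistLE G u v d := by
  classical
  constructor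
  · exact fun ⟨p, hp⟩ => ⟨p, hp.trans (min_le_left _ _)⟩
  · rintro ⟨p, hp⟩
    exact ⟨p.bypass, le_min ((SimpleGraph.Walk.length_bypass_le_length _).trans hp)
      (SimpleGraph.Walk.bypass_isPath p).length_lt.le⟩

end Game

/-- A cop with its speed and its reach lowered to at most `n`. -/
def Cop.clamp (C : Cop) (n : ℕ) (hn : 1 ≤ n) : Cop where
  speed := min C.speed n
  reach := min C.reach n
  status := C.status
  speed_pos := le_min C.speed_pos hn
  speed_of_active h := by rw [C.speed_of_active h, min_eq_left hn]

/-- A robber with its speed lowered to at most `n`. -/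
def Robber.clamp (R : Robber) (n : ℕ) (hn : 1 ≤ n) : Robber where
  speed := min R.speed n
  status := R.status
  speed_of_active h := by rw [R.speed_of_active h, min_eq_left hn]

section Clamp

variable {V : Type*} [Fintype V] {G : SimpleGraph V} {k : ℕ} {cop : Fin k → Cop}
  {R : Robber} (hn : 1 ≤ Fintype.card V)

theorem safe_clamp : Safe G (fun i => (cop i).clamp _ hn) = Safe G cop := by
  ext c v
  simp only [Safe, Cop.clamp, distLE_min]

theorem copMove_clamp : CopMove G (fun i => (cop i).clamp _ hn) = CopMove G cop := by
  ext c c'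
  simp only [CopMove, Cop.clamp, distLE_min]

theorem robberMove_clamp :
    RobberMove G (fun i => (cop i).clamp _ hn) (R.clamp _ hn) = RobberMove G cop R := by
  ext c r r'
  simp only [RobberMove, safe_clamp, Robber.clamp]
  refine and_congr_left fun _ => exists_congr fun p => and_congr_right fun hp => ?_
  simp [hp.length_lt.le]

theorem copsWin_clamp :
    CopsWin G (fun i => (cop i).clamp _ hn) (R.clamp _ hn) ↔ CopsWin G cop R := by
  have key (c : Fin k → V) (r : V) :
      CopsWinFrom G (fun i => (cop i).clamp _ hn) (R.clamp _ hn) c r ↔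
        CopsWinFrom G cop R c r := by
    constructor
    · intro h
      induction h with
      | capture hm hs =>
        rw [copMove_clamp] at hm
        rw [safe_clamp] at hs
        exact .capture hm hs
      | step hm _ ih =>
        rw [copMove_clamp] at hm
        rw [robberMove_clamp] at ih
        exact .step hm ih
    · intro h
      induction h with
      | capture hm hs =>
        rw [← copMove_clamp hn] at hm
        rw [← safe_clamp hn] at hs
        exact .capture hm hs
      | step hm _ ih =>
        rw [← copMove_clamp hn] at hm
        rw [← robberMove_clamp hn] at ih
        exact .step hm ih
  simp only [CopsWin, safe_clamp, key]

end Clamp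

/-! ### Safety of the reduction rule. -/

namespace Instance

/-- Only vertices of the class are deleted, and all `k + 1` vertices of `K` are remaining twins of
each of them. -/
theorem twinRich_keepOnly (I : Instance) {U S K : Set (Fin I.n)} (hK : K ⊆ I.nbhdClass U S)
    (hcard : K.ncard = I.k + 1) :
    TwinRich (SimpleGraph.Embedding.induce (G := I.graph)
      {v : Fin I.n | v ∈ I.nbhdClass U S → v ∈ K}) I.k := by
  intro v hv
  have hvC : v ∈ I.nbhdClass U S := by
    by_contra h
    exact hv ⟨⟨v, fun h' => absurd h' h⟩, rfl⟩
  rw [← Nat.succ_le_iff, Nat.succ_eq_add_one, ← hcard,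
    ← Set.ncard_image_of_injective _ (Subtype.val_injective)]
  refine Set.ncard_le_ncard (fun u hu => ⟨⟨u, fun _ => hu⟩, ?_, rfl⟩) (Set.toFinite _)
  exact (hK hu).2.trans hvC.2.symm

theorem keepOnly_safe (I : Instance) {U S K : Set (Fin I.n)} (hK : K ⊆ I.nbhdClass U S)
    (hcard : K.ncard = I.k + 1) :
    (I.keepOnly (I.nbhdClass U S) K).Connected ∧
      (I.Yes ↔ CopsWin (I.keepOnly (I.nbhdClass U S) K) I.cop I.robber) := by
  have hne : Nonempty {v : Fin I.n | v ∈ I.nbhdClass U S → v ∈ K} := by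
    obtain ⟨u, hu⟩ : K.Nonempty := Set.nonempty_of_ncard_ne_zero (by omega)
    exact ⟨⟨u, fun _ => hu⟩⟩
  have h := I.twinRich_keepOnly hK hcard
  exact ⟨h.connected I.connected, h.copsWin_iff⟩

end Instance

end CnR

/-! ### The kernel and its size. -/

namespace CnR

theorem copsWin_clamp_of_card_eq {V : Type*} [Fintype V] {G : SimpleGraph V} {k n : ℕ}
    {cop : Fin k → Cop} {R : Robber} (h : Fintype.card V = n) (hn : 1 ≤ n) :
    CopsWin G (fun i => (cop i).clamp n hn) (R.clamp n hn) ↔ CopsWin G cop R := by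
  subst h
  exact copsWin_clamp hn

namespace Instance

variable (I : Instance)

theorem n_pos : 1 ≤ I.n :=
  Fin.pos_iff_nonempty.2 I.connected.nonempty

theorem exists_isVertexCover_card_eq_vcn :
    ∃ U : Finset (Fin I.n), I.graph.IsVertexCover U ∧ U.card = I.vcn := by
  classical
  obtain ⟨U, hU, hcov⟩ := SimpleGraph.vertexCoverNum_exists I.graph
  refine ⟨U.toFinset, by simpa using hcov, ?_⟩
  rw [vcn, ← hU, Set.encard_eq_coe_toFinset_card, ENat.toNat_natCast]

theorem vcn_le_card {U : Finset (Fin I.n)} (hU : I.graph.IsVertexCover U) : I.vcn ≤ U.card := by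
  have h := hU.vertexCoverNum_le
  rw [Set.encard_coe_eq_coe_finsetCard] at h
  exact ENat.toNat_le_of_le_natCast h

theorem vcn_le_n : I.vcn ≤ I.n :=
  (I.vcn_le_card (U := Finset.univ) (by simp)).trans (by simp)

theorem vcn_pos (h : 2 ≤ I.n) : 1 ≤ I.vcn := by
  obtain ⟨U, hU, hcard⟩ := I.exists_isVertexCover_card_eq_vcn
  rw [← hcard, Nat.succ_le_iff, Finset.card_pos]
  have : Nontrivial (Fin I.n) := Fin.nontrivial_iff_two_le.2 h
  obtain ⟨w, hw⟩ := I.connected.preconnected.exists_adj_of_nontrivial ⟨0, I.n_pos⟩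
  exact (hU hw).elim (fun h => ⟨_, h⟩) fun h => ⟨_, h⟩

theorem yes_of_vcn_le (hk : 1 ≤ I.k) (h : I.vcn ≤ I.k) : I.Yes := by
  obtain ⟨U, hU, hcard⟩ := I.exists_isVertexCover_card_eq_vcn
  exact copsWin_of_isVertexCover I.connected hU hk (by simpa [hcard] using h)

open Classical in
/-- The twins of `v` that are smaller than `v`. -/
noncomputable def twinsBefore (v : Fin I.n) : Finset (Fin I.n) :=
  {u | u < v ∧ Twins I.graph u v}

/-- A vertex is kept if it is among the first `k + 1` vertices of its twin class. -/
def Keeps (v : Fin I.n) : Prop :=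
  (I.twinsBefore v).card ≤ I.k

open Classical in
/-- The list of the vertices that are kept. -/
noncomputable def kept : List (Fin I.n) :=
  (List.finRange I.n).filter fun v => I.Keeps v

theorem mem_kept {v : Fin I.n} : v ∈ I.kept ↔ I.Keeps v := by
  simp [kept]

theorem nodup_kept : I.kept.Nodup :=
  (List.nodup_finRange _).filter _

theorem length_kept_le : I.kept.length ≤ I.n :=
  (List.length_filter_le _ _).trans (by simp)

theorem length_kept_pos : 1 ≤ I.kept.length := by
  refine List.length_pos_of_mem (a := (⟨0, I.n_pos⟩ : Fin I.n)) (I.mem_kept.2 ?_)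
  have h : I.twinsBefore ⟨0, I.n_pos⟩ = ∅ := by
    ext u
    simp [twinsBefore, Fin.lt_def]
  simp [Keeps, h]

/-- The graph induced by the vertices that are kept, embedded into the graph. -/
noncomputable def keptEmbedding : I.graph.comap I.kept.get ↪g I.graph where
  toFun := I.kept.get
  inj' := List.nodup_iff_injective_get.1 I.nodup_kept
  map_rel_iff' := Iff.rfl

theorem twinRich_kept : TwinRich I.keptEmbedding I.k := by
  classical
  intro v hv
  have hvk : ¬ I.Keeps v := fun h => hv (List.mem_iff_get.1 (I.mem_kept.2 h))
  let T : Finset (Fin I.n) := {u | Twins I.graph u v ∧ ¬ I.Keeps u}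
  have hT : T.Nonempty := ⟨v, by simpa [T] using ⟨rfl, hvk⟩⟩
  -- Take the least deleted twin `m` of `v`. It has more than `k` smaller twins, and by minimality
  -- they are all kept.
  obtain ⟨m, hm, hmin⟩ := T.exists_min_image id hT
  obtain ⟨hmv, hmk⟩ : Twins I.graph m v ∧ ¬ I.Keeps m := by simpa [T] using hm
  rw [Keeps, not_le] at hmk
  refine hmk.trans_le ?_
  rw [← Set.ncard_coe_finset, ← Set.ncard_image_of_injective {w | _} I.keptEmbedding.injective]
  refine Set.ncard_le_ncard (fun u hu => ?_) (Set.toFinite _)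
  obtain ⟨hum, hut⟩ : u < m ∧ Twins I.graph u m := by simpa [twinsBefore] using hu
  have huk : I.Keeps u := by
    by_contra h
    exact absurd (hmin u (by simpa [T] using ⟨hut.trans hmv, h⟩)) (not_le.2 hum)
  obtain ⟨i, hi⟩ := List.mem_iff_get.1 (I.mem_kept.2 huk)
  have hi : I.keptEmbedding i = u := hi
  exact ⟨i, (congrArg (Twins I.graph · v) hi).mpr (hut.trans hmv), hi⟩

/-- All other members of `A` are smaller twins of its largest member, which has at most `k` of these
because it is kept. -/
theorem card_keeps_twins_le (A : Finset (Fin I.n)) (hA : ∀ u ∈ A, I.Keeps u)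
    (h : ∀ u ∈ A, ∀ v ∈ A, Twins I.graph u v) : A.card ≤ I.k + 1 := by
  obtain rfl | hne := A.eq_empty_or_nonempty
  · simp
  obtain ⟨m, hm, hmax⟩ := A.exists_max_image id hne
  rw [← Finset.card_erase_add_one hm]
  refine Nat.succ_le_succ ((Finset.card_le_card fun u hu => ?_).trans (hA m hm))
  rw [Finset.mem_erase] at hu
  simpa [twinsBefore] using ⟨lt_of_le_of_ne (hmax u hu.2) hu.1, h u hu.2 m hm⟩

/-- The neighbourhood of a vertex outside a minimum cover `U` is a subset of `U`. So there are at
most `2 ^ vcn` classes outside `U`, each with at most `k + 1 ≤ vcn` kept vertices. -/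
theorem length_kept_le_of_lt_vcn (hk : I.k + 1 ≤ I.vcn) :
    I.kept.length ≤ I.vcn + I.vcn * 2 ^ I.vcn := by
  classical
  obtain ⟨U, hU, hcard⟩ := I.exists_isVertexCover_card_eq_vcn
  rw [← List.toFinset_card_of_nodup I.nodup_kept, ← Finset.card_sdiff_add_card_inter _ U, add_comm]
  refine add_le_add (hcard ▸ Finset.card_le_card Finset.inter_subset_right) ?_
  refine (Finset.card_le_mul_card_image_of_maps_to
    (f := fun v => ({w | I.graph.Adj v w} : Finset (Fin I.n))) (t := U.powerset) ?_ (I.k + 1)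
    ?_).trans ?_
  · intro v hv
    simp only [Finset.mem_powerset]
    intro w hw
    have hvw : I.graph.Adj v w := by simpa using hw
    exact (hU hvw).resolve_left (Finset.mem_sdiff.1 hv).2
  · intro S _
    refine I.card_keeps_twins_le _ (fun u hu => ?_) fun u hu v hv => ?_
    · simp only [Finset.mem_filter, Finset.mem_sdiff, List.mem_toFinset, mem_kept] at hu
      exact hu.1.1
    · have h := (Finset.mem_filter.1 hu).2.trans (Finset.mem_filter.1 hv).2.symm
      ext w
      simpa using Finset.ext_iff.1 h w
  · rw [Finset.card_powerset, hcard]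
    exact Nat.mul_le_mul_right _ hk

/-- The instance in which only the kept vertices remain, and no number exceeds the number of
vertices. -/
noncomputable def reduce : Instance where
  n := I.kept.length
  graph := I.graph.comap I.kept.get
  connected :=
    have : Nonempty (Fin I.kept.length) := ⟨⟨0, I.length_kept_pos⟩⟩
    I.twinRich_kept.connected I.connected
  k := I.k
  cop i := (I.cop i).clamp _ I.length_kept_pos
  robber := I.robber.clamp _ I.length_kept_pos

theorem yes_reduce_iff : I.reduce.Yes ↔ I.Yes := by
  have : Nonempty (Fin I.kept.length) := ⟨⟨0, I.length_kept_pos⟩⟩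
  exact (copsWin_clamp_of_card_eq (Fintype.card_fin _) I.length_kept_pos).trans
    I.twinRich_kept.copsWin_iff.symm

/-- One cop on the graph with one vertex. -/
def trivialYes : Instance where
  n := 1
  graph := ⊥
  connected := ⟨.of_subsingleton⟩
  k := 1
  cop _ := ⟨1, 0, .flexible, le_rfl, fun h => nomatch h⟩
  robber := ⟨0, .flexible, fun h => nomatch h⟩

theorem yes_trivialYes : trivialYes.Yes :=
  ⟨fun _ => (0 : Fin 1), fun r hr =>
    absurd (Subsingleton.elim (α := Fin 1) 0 r) (hr.ne (0 : Fin 1))⟩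

/-- The largest number up to which the vertex cover number is determined: at most `k`, and
with `2 ^ budget` at most the number of vertices. -/
def budget : ℕ :=
  min I.k (Nat.log 2 I.n)

/-- A sufficient condition for a win of the cops that can be tested in polynomial time. -/
def Easy : Prop :=
  1 ≤ I.k ∧ (I.n ≤ I.k ∨ I.vcn ≤ I.budget)

open Classical in
/-- The kernelization. -/
noncomputable def kernel : Instance :=
  if I.Easy then trivialYes else I.reduce

theorem yes_iff_yes_kernel : I.Yes ↔ I.kernel.Yes := by
  rw [kernel]
  split_ifs with h
  · refine iff_of_true (I.yes_of_vcn_le h.1 ?_) yes_trivialYes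
    exact h.2.elim (I.vcn_le_n.trans ·) fun h => h.trans (min_le_left _ _)
  · exact I.yes_reduce_iff.symm

/-- For `k = 0`, two vertices already force `vcn ≥ 1 = k + 1`. For `k ≥ 1` the budget is below
`vcn`: if the budget is `k`, twin reduction gives the bound; if it is `log₂ n`, the graph itself has
fewer than `2 ^ vcn` vertices. -/
theorem not_easy_cases (h : ¬ I.Easy) :
    (I.n = 1 ∧ I.k = 0) ∨ I.k + 1 ≤ I.vcn ∨ (1 ≤ I.vcn ∧ I.k < I.n ∧ I.n ≤ 2 ^ I.vcn) := by
  have hn := I.n_pos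
  obtain hk | hk := Nat.eq_zero_or_pos I.k
  · obtain h1 | h2 := hn.eq_or_lt
    · exact .inl ⟨h1.symm, hk⟩
    · exact .inr (.inl (by simpa [hk] using I.vcn_pos h2))
  · have h' : I.k < I.n ∧ I.budget < I.vcn := by
      simpa [Easy, Nat.succ_le_of_lt hk] using h
    obtain hb | hb := min_choice I.k (Nat.log 2 I.n)
    · exact .inr (.inl (by rw [← hb]; exact h'.2))
    · refine .inr (.inr ⟨by omega, h'.1, ?_⟩)
      have := h'.2
      rw [budget, hb] at this
      exact (Nat.lt_pow_of_log_lt one_lt_two this).le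

theorem n_kernel_le : I.kernel.n ≤ max 1 (I.vcn + I.vcn * 2 ^ I.vcn) := by
  rw [kernel]
  split_ifs with h
  · exact le_max_left _ _
  · obtain h | h | h := I.not_easy_cases h
    · exact le_max_of_le_left (I.length_kept_le.trans h.1.le)
    · exact le_max_of_le_right (I.length_kept_le_of_lt_vcn h)
    · refine le_max_of_le_right (I.length_kept_le.trans (h.2.2.trans ?_))
      exact (Nat.le_mul_of_pos_left _ h.1).trans (Nat.le_add_left _ _)

theorem k_kernel_le : I.kernel.k ≤ I.vcn + 2 ^ I.vcn := by
  rw [kernel]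
  split_ifs with h
  · exact Nat.one_le_two_pow.trans (Nat.le_add_left _ _)
  · change I.k ≤ _
    have := Nat.one_le_two_pow (n := I.vcn)
    rcases I.not_easy_cases h with h | h | h <;> omega

/-- No speed and no reach exceeds the number of vertices. -/
def Bounded : Prop :=
  (∀ i, (I.cop i).speed ≤ I.n ∧ (I.cop i).reach ≤ I.n) ∧ I.robber.speed ≤ I.n

theorem bounded_kernel : I.kernel.Bounded := by
  rw [kernel]
  split_ifs with h
  · exact ⟨fun i => ⟨le_rfl, zero_le_one⟩, zero_le_one⟩
  · exact ⟨fun i => ⟨min_le_right _ _, min_le_right _ _⟩, min_le_right _ _⟩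

theorem length_encode : I.encode.length = I.n * I.n + 3 * I.k + 4 := by
  simp only [encode, List.length_append, List.length_flatMap, List.length_map,
    List.length_finRange, List.length_cons, List.length_nil, List.map_const', List.sum_replicate,
    smul_eq_mul]
  ring

end Instance

/-! ### The encoding length of the kernel. -/

theorem bitSize_le_of_forall_le {l : List ℕ} {E : ℕ} (h : ∀ a ∈ l, a ≤ E) :
    RAM.bitSize l ≤ l.length * (E + 1) := by
  have hl := List.sum_le_card_nsmul (l.map fun a => Nat.size a + 1) (E + 1) fun x hx => by
    obtain ⟨a, ha, rfl⟩ := List.mem_map.1 hx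
    exact Nat.succ_le_succ ((Nat.size_le.2 Nat.lt_two_pow_self).trans (h a ha))
  simpa [RAM.bitSize] using hl

theorem length_le_bitSize (l : List ℕ) : l.length ≤ RAM.bitSize l := by
  have hl := List.card_nsmul_le_sum (l.map fun a => Nat.size a + 1) 1 fun x hx => by
    obtain ⟨a, ha, rfl⟩ := List.mem_map.1 hx
    exact Nat.succ_le_succ (Nat.zero_le _)
  simpa only [RAM.bitSize, List.length_map, smul_eq_mul, mul_one] using hl

namespace Instance

theorem statusCode_le (s : Status) : statusCode s ≤ 2 := by
  cases s <;> simp [statusCode]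

theorem bitSize_encode_le {I : Instance} (h : I.Bounded) {B Q : ℕ} (hn : I.n ≤ B) (hk : I.k ≤ Q) :
    RAM.bitSize I.encode ≤ (B * B + 3 * Q + 4) * (B + Q + 3) := by
  -- The summand `2` accounts for the status codes.
  refine (bitSize_le_of_forall_le (E := B + Q + 2) fun a ha => ?_).trans ?_
  · simp only [encode, List.mem_append, List.mem_flatMap, List.mem_map, List.mem_cons,
      List.not_mem_nil, or_false] at ha
    obtain ⟨h₁, h₂⟩ := h
    obtain (((rfl | ⟨u, -, v, -, rfl⟩) | rfl) | ⟨i, -, rfl | rfl | rfl⟩) | rfl | rfl := ha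
    · omega
    · split_ifs <;> omega
    · omega
    · have := (h₁ i).1; omega
    · have := (h₁ i).2; omega
    · have := statusCode_le (I.cop i).status; omega
    · omega
    · have := statusCode_le I.robber.status; omega
  · rw [length_encode]
    gcongr

end Instance

/-- A bound for the encoding length of the kernel. -/
def kernelSizeBound (v : ℕ) : ℕ :=
  ((1 + (v + v * 2 ^ v)) * (1 + (v + v * 2 ^ v)) + 3 * (v + 2 ^ v) + 4) *
    ((1 + (v + v * 2 ^ v)) + (v + 2 ^ v) + 3)

theorem computable_kernelSizeBound : Computable kernelSizeBound := by
  have hpow : Primrec fun v : ℕ => 2 ^ v := by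
    refine (Primrec.nat_rec₁ (f := fun _ x : ℕ => x + x) 1
      (Primrec.nat_add.comp Primrec.snd Primrec.snd)).of_eq fun v => ?_
    induction v with
    | zero => rfl
    | succ v ih => simp only [ih, pow_succ]; omega
  have add {f g : ℕ → ℕ} (hf : Primrec f) (hg : Primrec g) : Primrec fun v => f v + g v :=
    Primrec.nat_add.comp hf hg
  have mul {f g : ℕ → ℕ} (hf : Primrec f) (hg : Primrec g) : Primrec fun v => f v * g v :=
    Primrec.nat_mul.comp hf hg
  have hB := add (.const 1) (add .id (mul .id hpow))
  have hQ := add .id hpow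
  exact (mul (add (add (mul hB hB) (mul (.const 3) hQ)) (.const 4))
    (add (add hB hQ) (.const 3))).to_comp

theorem Instance.bitSize_kernel_le (I : Instance) :
    RAM.bitSize I.kernel.encode ≤ kernelSizeBound I.vcn :=
  bitSize_encode_le I.bounded_kernel (I.n_kernel_le.trans (by omega)) I.k_kernel_le

end CnR

/-! ### A program logic with time bounds. -/

namespace RAM

@[simp]
theorem Memory.reg_setReg (m : Memory) (x v y : ℕ) :
    (m.setReg x v).reg y = if y = x then v else m.reg y := by
  simp [setReg, Function.update_apply]

@[simp]
theorem Memory.arr_setReg (m : Memory) (x v : ℕ) : (m.setReg x v).arr = m.arr := rfl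

@[simp]
theorem Memory.reg_setArr (m : Memory) (a i v : ℕ) : (m.setArr a i v).reg = m.reg := rfl

@[simp]
theorem Memory.arr_setArr (m : Memory) (a i v b j : ℕ) :
    (m.setArr a i v).arr b j = if b = a ∧ j = i then v else m.arr b j := by
  obtain rfl | h := eq_or_ne b a <;> simp [setArr, Function.update_apply, *]

namespace Prog

/-- A time bound that is valid as long as no loop is repeated more than `X` times. -/
noncomputable def timeBound : Prog → Polynomial ℕ
  | skip => 1
  | assign _ e => .C (e.cost + 1)
  | write _ i e => .C (i.cost + e.cost + 1)
  | seq p q => p.timeBound + q.timeBound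
  | cond e p q => .C (e.cost + 1) + (p.timeBound + q.timeBound)
  | loop e p => (.X + 1) * (.C (e.cost + 1) + p.timeBound)

/-- The registers that are assigned by a program. -/
def regs : Prog → List ℕ
  | skip => []
  | assign x _ => [x]
  | write _ _ _ => []
  | seq p q => p.regs ++ q.regs
  | cond _ p q => p.regs ++ q.regs
  | loop _ p => p.regs

/-- The arrays that are written to by a program. -/
def arrs : Prog → List ℕ
  | skip => []
  | assign _ _ => []
  | write a _ _ => [a]
  | seq p q => p.arrs ++ q.arrs
  | cond _ p q => p.arrs ++ q.arrs
  | loop _ p => p.arrs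

/-- `forLoop x y p` runs `p` with the values `0, 1, ...` of the register `x` that are less than the
value of the register `y`. -/
def forLoop (x y : ℕ) (p : Prog) : Prog :=
  .seq (.assign x (.const 0))
    (.loop (.sub (.reg y) (.reg x)) (.seq p (.assign x (.add (.reg x) (.const 1)))))

end Prog

/-- The memories agree on everything the program `p` does not change. -/
structure Frame (p : Prog) (m m' : Memory) : Prop where
  reg : ∀ x ∉ p.regs, m'.reg x = m.reg x
  arr : ∀ a ∉ p.arrs, m'.arr a = m.arr a

theorem Frame.refl (p : Prog) (m : Memory) : Frame p m m :=
  ⟨fun _ _ => rfl, fun _ _ => rfl⟩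

theorem Frame.trans {p : Prog} {m m' m'' : Memory} (h : Frame p m m') (h' : Frame p m' m'') :
    Frame p m m'' :=
  ⟨fun x hx => (h'.reg x hx).trans (h.reg x hx), fun a ha => (h'.arr a ha).trans (h.arr a ha)⟩

theorem Frame.mono {p q : Prog} {m m' : Memory} (h : Frame p m m') (hr : p.regs ⊆ q.regs)
    (ha : p.arrs ⊆ q.arrs) : Frame q m m' :=
  ⟨fun x hx => h.reg x fun h => hx (hr h), fun a hx => h.arr a fun h => hx (ha h)⟩

/-- What a program leaves unchanged is read off its syntax, so in later proofs preservation of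
registers and arrays is settled by `decide`. -/
theorem Exec.frame {p : Prog} {m m' : Memory} {t : ℕ} (h : Exec p m t m') : Frame p m m' := by
  induction h with
  | skip | loop_done => exact .refl _ _
  | assign m x e =>
    refine ⟨fun y hy => ?_, fun _ _ => rfl⟩
    simp_all [Prog.regs]
  | write m a i e =>
    refine ⟨fun _ _ => rfl, fun b hb => ?_⟩
    ext j
    simp_all [Prog.arrs]
  | seq _ _ ih ih' =>
    exact (ih.mono (by simp [Prog.regs]) (by simp [Prog.arrs])).trans
      (ih'.mono (by simp [Prog.regs]) (by simp [Prog.arrs]))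
  | cond_true _ _ ih | cond_false _ _ ih =>
    exact ih.mono (by simp [Prog.regs]) (by simp [Prog.arrs])
  | loop_step _ _ _ ih ih' =>
    exact (ih.mono (by simp [Prog.regs]) (by simp [Prog.arrs])).trans ih'

/-- Started in `m`, the program `p` halts within its time bound for the parameter `N`, in a memory
that satisfies `Q`. -/
def Runs (N : ℕ) (p : Prog) (m : Memory) (Q : Memory → Prop) : Prop :=
  ∃ t m', Exec p m t m' ∧ t ≤ p.timeBound.eval N ∧ Q m'

theorem polyTimeComputable_of_runs {α : Type*} {enc : α → List ℕ} {f : α → α} (p : Prog)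
    (h : ∀ x, Runs (bitSize (enc x)) p (start (enc x)) fun m => Output m (enc (f x))) :
    PolyTimeComputable enc f :=
  ⟨p, p.timeBound, h⟩

namespace Runs

variable {N : ℕ} {p q : Prog} {m : Memory} {Q Q' : Memory → Prop}

theorem mono_frame (h : Runs N p m Q) (hQ : ∀ m', Q m' → Frame p m m' → Q' m') :
    Runs N p m Q' := by
  obtain ⟨t, m', he, ht, hm⟩ := h
  exact ⟨t, m', he, ht, hQ m' hm he.frame⟩

theorem mono (h : Runs N p m Q) (hQ : ∀ m', Q m' → Q' m') : Runs N p m Q' :=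
  h.mono_frame fun m' hm _ => hQ m' hm

theorem skip (h : Q m) : Runs N .skip m Q :=
  ⟨1, m, .skip m, by simp [Prog.timeBound], h⟩

theorem assign {x : ℕ} {e : Term} (h : Q (m.setReg x (e.eval m))) : Runs N (.assign x e) m Q :=
  ⟨_, _, .assign m x e, by simp [Prog.timeBound], h⟩

theorem write {a : ℕ} {i e : Term} (h : Q (m.setArr a (i.eval m) (e.eval m))) :
    Runs N (.write a i e) m Q :=
  ⟨_, _, .write m a i e, by simp [Prog.timeBound], h⟩

theorem seq (h : Runs N p m fun m' => Runs N q m' Q) : Runs N (.seq p q) m Q := by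
  obtain ⟨t, m', he, ht, t', m'', he', ht', hm⟩ := h
  exact ⟨_, _, .seq he he', by simpa [Prog.timeBound] using add_le_add ht ht', hm⟩

theorem seq_frame {P : Memory → Prop} (h : Runs N p m P)
    (h' : ∀ m', P m' → Frame p m m' → Runs N q m' Q) : Runs N (.seq p q) m Q :=
  seq (h.mono_frame h')

theorem cond {e : Term} (h : e.eval m ≠ 0 → Runs N p m Q) (h' : e.eval m = 0 → Runs N q m Q) :
    Runs N (.cond e p q) m Q := by
  by_cases he : e.eval m = 0
  · obtain ⟨t, m', hx, ht, hm⟩ := h' he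
    refine ⟨_, _, .cond_false he hx, ?_, hm⟩
    simp only [Prog.timeBound, Polynomial.eval_add, Polynomial.eval_C]
    omega
  · obtain ⟨t, m', hx, ht, hm⟩ := h he
    refine ⟨_, _, .cond_true he hx, ?_, hm⟩
    simp only [Prog.timeBound, Polynomial.eval_add, Polynomial.eval_C]
    omega

/-- The rule for loops with a variant. -/
theorem loop {e : Term} (J : ℕ → Memory → Prop) {j : ℕ} (hj : j ≤ N) (h₀ : J j m)
    (hdone : ∀ m, J 0 m → e.eval m = 0) (hne : ∀ i m, J (i + 1) m → e.eval m ≠ 0)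
    (hstep : ∀ i m, J (i + 1) m → Runs N p m (J i)) : Runs N (.loop e p) m (J 0) := by
  have key : ∃ t m', Exec (.loop e p) m t m' ∧
      -- There are `j` passes and one more evaluation of the test, which ends the loop.
      t ≤ (j + 1) * (e.cost + 1 + p.timeBound.eval N) ∧ J 0 m' := by
    clear hj
    induction j generalizing m with
    | zero => exact ⟨_, _, .loop_done (hdone m h₀), by simp, h₀⟩
    | succ j ih =>
      obtain ⟨t, m', he, ht, hm⟩ := hstep j m h₀
      obtain ⟨t', m'', he', ht', hm'⟩ := ih hm
      refine ⟨_, _, .loop_step (hne j m h₀) he he', ?_, hm'⟩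
      rw [add_mul _ 1, one_mul]
      omega
  obtain ⟨t, m', he, ht, hm⟩ := key
  refine ⟨t, m', he, ht.trans ?_, hm⟩
  simp only [Prog.timeBound, Polynomial.eval_mul, Polynomial.eval_add, Polynomial.eval_C,
    Polynomial.eval_X, Polynomial.eval_one]
  gcongr

/-- The rule for `forLoop`, with an invariant `J` that is indexed by the number of repetitions done
and does not depend on the loop variable. -/
theorem forLoop {x y n : ℕ} (J : ℕ → Memory → Prop) (hy : m.reg y = n) (hn : n ≤ N)
    (hxy : y ≠ x) (hx : x ∉ p.regs) (hyp : y ∉ p.regs)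
    (hJ : ∀ i m v, J i m → J i (m.setReg x v)) (h₀ : J 0 m)
    (hstep : ∀ i < n, ∀ m', J i m' → m'.reg x = i → Frame (.forLoop x y p) m m' →
      Runs N p m' (J (i + 1))) :
    Runs N (.forLoop x y p) m (J n) := by
  have hp : Frame (.forLoop x y p) m (m.setReg x 0) :=
    ⟨fun z hz => by simp_all [Prog.regs, Prog.forLoop], fun _ _ => rfl⟩
  refine seq (assign ?_)
  have key := loop (N := N) (e := .sub (.reg y) (.reg x))
    (p := .seq p (.assign x (.add (.reg x) (.const 1)))) (m := m.setReg x 0)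
    -- The variant `j` counts the passes to come, while `J` is indexed by the passes already done,
    -- hence `n - j`.
    (fun j m' => j ≤ n ∧ J (n - j) m' ∧ m'.reg x = n - j ∧ m'.reg y = n ∧
      Frame (.forLoop x y p) m m') (j := n) hn
    ⟨le_rfl, by simpa using hJ _ _ _ h₀, by simp, by simp [hxy, hy], hp⟩ ?_ ?_ ?_
  · exact key.mono fun m' h => h.2.1
  · rintro m' ⟨-, -, hx', hy', -⟩
    simp [Term.eval, hx', hy']
  · rintro i m' ⟨hi, -, hx', hy', -⟩
    simp only [Term.eval, hx', hy']
    omega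
  · rintro i m' ⟨hi, hJ', hx', hy', hf⟩
    refine seq_frame (hstep _ (by omega) m' hJ' hx' hf) fun m'' hm'' hf' => assign ?_
    have hidx : n - (i + 1) + 1 = n - i := by omega
    rw [hidx] at hm''
    refine ⟨by omega, hJ _ _ _ hm'', ?_, ?_, ?_⟩
    · simp [Term.eval, hf'.reg x hx, hx', hidx]
    · simp [hxy, hf'.reg y hyp, hy']
    · have hf'' : Frame (.forLoop x y p) m' m'' :=
        hf'.mono (by simp [Prog.regs, Prog.forLoop]) (by simp [Prog.arrs, Prog.forLoop])
      refine (hf.trans hf'').trans ⟨fun z hz => ?_, fun _ _ => rfl⟩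
      simp_all [Prog.regs, Prog.forLoop]

end Runs

end RAM

/-! ### Positions in the encoding. -/

theorem List.getD_flatMap_of_length_eq {α β : Type*} {f : α → List β} {w : ℕ} (d : β) :
    ∀ {l : List α} (_ : ∀ a ∈ l, (f a).length = w) {i j : ℕ} (hi : i < l.length) (_ : j < w),
      (l.flatMap f).getD (i * w + j) d = (f l[i]).getD j d
  | [], _, i, _, hi, _ => absurd hi (Nat.not_lt_zero i)
  | a :: l, hf, 0, j, _, hj => by
    rw [List.flatMap_cons, List.getD_append _ _ _ _ (by simpa [hf a] using hj)]
    simp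
  | a :: l, hf, i + 1, j, hi, hj => by
    have ha : (f a).length = w := hf a (by simp)
    rw [List.flatMap_cons, List.getD_append_right _ _ _ _ (by rw [ha]; nlinarith), ha,
      show (i + 1) * w + j - w = i * w + j by rw [add_mul]; omega,
      List.getD_flatMap_of_length_eq d (fun b hb => hf b (by simp [hb])) (by simpa using hi) hj]
    simp

namespace CnR

namespace Instance

variable (I : Instance)

/-- Adjacency of vertices that are given by their numbers. -/
def AdjNat (u v : ℕ) : Prop :=
  ∃ (hu : u < I.n) (hv : v < I.n), I.graph.Adj ⟨u, hu⟩ ⟨v, hv⟩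

open Classical in
/-- The entries of the adjacency matrix. -/
noncomputable def bit (u v : ℕ) : ℕ :=
  if I.AdjNat u v then 1 else 0

/-- The numbers in the description of a cop. -/
def copEntries (i : ℕ) : List ℕ :=
  if h : i < I.k then [(I.cop ⟨i, h⟩).speed, (I.cop ⟨i, h⟩).reach, statusCode (I.cop ⟨i, h⟩).status]
  else [0, 0, 0]

theorem length_copEntries (i : ℕ) : (I.copEntries i).length = 3 := by
  unfold copEntries
  split_ifs <;> rfl

theorem flatMap_range {α : Type*} (n : ℕ) (f : ℕ → List α) :
    (List.range n).flatMap f = (List.finRange n).flatMap fun i : Fin n => f i := by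
  rw [← List.map_coe_finRange_eq_range, List.flatMap_map]

theorem map_range {α : Type*} (n : ℕ) (f : ℕ → α) :
    (List.range n).map f = (List.finRange n).map fun i : Fin n => f i := by
  rw [← List.map_coe_finRange_eq_range, List.map_map]
  rfl

/-- Blocks indexed by `List.range` grow by one at the end when a loop makes one more pass, which
suits loop invariants better than `List.finRange`. -/
theorem encode_eq : I.encode =
    [I.n] ++ ((List.range I.n).flatMap fun u => (List.range I.n).map fun v => I.bit u v) ++ [I.k] ++
      (List.range I.k).flatMap I.copEntries ++ [I.robber.speed, statusCode I.robber.status] := by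
  classical
  have hbit (u v : Fin I.n) : I.bit u v = if I.graph.Adj u v then 1 else 0 := by
    have h : I.AdjNat u v ↔ I.graph.Adj u v :=
      ⟨fun ⟨_, _, h⟩ => h, fun h => ⟨u.isLt, v.isLt, h⟩⟩
    simp [bit, h]
  simp only [encode, flatMap_range, map_range, hbit, copEntries, Fin.is_lt, dite_true]

theorem length_rows : ((List.range I.n).flatMap fun u =>
    (List.range I.n).map fun v => I.bit u v).length = I.n * I.n := by
  simp

theorem length_cops : ((List.range I.k).flatMap I.copEntries).length = 3 * I.k := by
  simp [List.length_flatMap, length_copEntries, mul_comm]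

theorem encode_getD_zero : I.encode.getD 0 0 = I.n := by
  simp [encode_eq]

theorem encode_getD_bit {u v : ℕ} (hu : u < I.n) (hv : v < I.n) :
    I.encode.getD (1 + u * I.n + v) 0 = I.bit u v := by
  have hlt : u * I.n + v < I.n * I.n := by nlinarith
  rw [encode_eq, List.getD_append _ _ _ _ (by simp; omega),
    List.getD_append _ _ _ _ (by simp; omega), List.getD_append _ _ _ _ (by simp; omega),
    List.getD_append_right _ _ _ _ (by simp; omega)]
  rw [show 1 + u * I.n + v - [I.n].length = u * I.n + v by simp; omega,
    List.getD_flatMap_of_length_eq 0 (by simp) (by simpa using hu) hv]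
  simp [List.getD_eq_getElem?_getD, hv]

theorem encode_getD_k : I.encode.getD (1 + I.n * I.n) 0 = I.k := by
  have hlen := I.length_rows
  rw [encode_eq, List.getD_append _ _ _ _ (by simp; omega),
    List.getD_append _ _ _ _ (by simp; omega),
    List.getD_append_right _ _ _ _ (by rw [List.length_append, hlen]; simp)]
  simp [add_comm]

theorem encode_getD_cop {i j : ℕ} (hi : i < I.k) (hj : j < 3) :
    I.encode.getD (2 + I.n * I.n + i * 3 + j) 0 = (I.copEntries i).getD j 0 := by
  have hlen := I.length_cops
  rw [encode_eq, List.getD_append _ _ _ _ (by simp [length_copEntries]; omega),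
    List.getD_append_right _ _ _ _ (by simp; omega)]
  rw [show 2 + I.n * I.n + i * 3 + j - _ = i * 3 + j by simp; omega,
    List.getD_flatMap_of_length_eq 0 (fun i _ => I.length_copEntries i) (by simpa using hi) hj]
  simp

theorem encode_getD_robber {j : ℕ} :
    I.encode.getD (2 + I.n * I.n + I.k * 3 + j) 0 =
      [I.robber.speed, statusCode I.robber.status].getD j 0 := by
  have hlen := I.length_cops
  rw [encode_eq, List.getD_append_right _ _ _ _ (by simp [length_copEntries]; omega)]
  congr 1
  simp [length_copEntries]
  omega

theorem n_le_bitSize : I.n ≤ RAM.bitSize I.encode :=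
  le_trans (by rw [length_encode]; nlinarith [I.n_pos]) (length_le_bitSize _)

theorem k_le_bitSize : I.k ≤ RAM.bitSize I.encode :=
  le_trans (by rw [length_encode]; nlinarith [I.n_pos]) (length_le_bitSize _)

end Instance

open RAM Instance

/-! ### Reading the input. -/

namespace Program

/-- Reads the number of vertices and the number of cops, and computes the positions at which the
rows of the adjacency matrix start. -/
def setup : Prog :=
  .seq (.assign 1 (.get 0 (.const 0))) <|
  .seq (.write 1 (.const 0) (.const 1)) <|
  .seq (.forLoop 7 1 (.write 1 (.add (.reg 7) (.const 1)) (.add (.get 1 (.reg 7)) (.reg 1)))) <|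
  -- The start of the nonexistent row `n` is the position just after the matrix, which holds the
  -- number of cops.
  .assign 2 (.get 0 (.get 1 (.reg 1)))

/-- The input is available. -/
structure Ready (I : Instance) (m : Memory) : Prop where
  n_eq : m.reg 1 = I.n
  k_eq : m.reg 2 = I.k
  row_eq : ∀ u ≤ I.n, m.arr 1 u = 1 + u * I.n
  input_eq : ∀ i, m.arr 0 i = I.encode.getD i 0

theorem Ready.frame {I : Instance} {p : Prog} {m m' : Memory} (h : Ready I m) (hf : Frame p m m')
    (h₁ : 1 ∉ p.regs) (h₂ : 2 ∉ p.regs) (h₃ : 0 ∉ p.arrs) (h₄ : 1 ∉ p.arrs) : Ready I m' where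
  n_eq := (hf.reg 1 h₁).trans h.n_eq
  k_eq := (hf.reg 2 h₂).trans h.k_eq
  row_eq u hu := by rw [hf.arr 1 h₄]; exact h.row_eq u hu
  input_eq i := by rw [hf.arr 0 h₃]; exact h.input_eq i

theorem runs_setup (I : Instance) :
    Runs (bitSize I.encode) setup (start I.encode) (Ready I) := by
  refine .seq (.assign (.seq (.write ?_)))
  refine .seq_frame (P := fun m => ∀ u ≤ I.n, m.arr 1 u = 1 + u * I.n)
    (Runs.forLoop (fun i m => ∀ u ≤ i, m.arr 1 u = 1 + u * I.n) ?_ I.n_le_bitSize (by decide)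
      (by decide) (by decide) ?_ ?_ ?_) ?_
  · simp [Term.eval, start, ← encode_getD_zero]
  · exact fun _ _ _ h => h
  · intro u hu
    obtain rfl : u = 0 := by omega
    simp [Term.eval]
  · intro i hi m hm hi' hf
    refine .write fun u hu => ?_
    have h1 : m.reg 1 = I.n := by
      rw [hf.reg 1 (by decide)]
      simp [Term.eval, start, ← encode_getD_zero]
    simp only [Term.eval, Memory.arr_setArr, true_and, hi', h1]
    split_ifs with h
    · rw [hm i le_rfl, h]; ring
    · exact hm u (by omega)
  · intro m hm hf
    have h1 : m.reg 1 = I.n := by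
      rw [hf.reg 1 (by decide)]
      simp [Term.eval, start, ← encode_getD_zero]
    have h0 (i : ℕ) : m.arr 0 i = I.encode.getD i 0 := by
      rw [hf.arr 0 (by decide)]
      simp [start]
    refine .assign ⟨by simp [h1], ?_, by simpa using hm, by simpa using h0⟩
    have h2 : (Term.get 0 (.get 1 (.reg 1))).eval m = I.k := by
      simp only [Term.eval, h1, hm I.n le_rfl, h0, encode_getD_k]
    simp [h2]

/-- An entry of the adjacency matrix. -/
def adjTerm (u v : Term) : Term :=
  .get 0 (.add (.get 1 u) v)

theorem Ready.eval_adjTerm {I : Instance} {m : Memory} (h : Ready I m) {u v : Term}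
    (hu : u.eval m < I.n) (hv : v.eval m < I.n) :
    (adjTerm u v).eval m = I.bit (u.eval m) (v.eval m) := by
  simp only [adjTerm, Term.eval]
  rw [h.row_eq _ hu.le, h.input_eq, encode_getD_bit _ hu hv]

end Program

end CnR

/-! ### A bounded search for a vertex cover. -/

namespace CnR

/-- The state of a search for a vertex cover: the vertices chosen so far, a number whose binary
digits determine the choices to come, and whether the search has failed. -/
structure Search where
  chosen : Finset ℕ
  code : ℕ
  fail : Bool

namespace Search

variable (adj : ℕ → ℕ → Prop) (t : ℕ)

open Classical in
/-- Treats one pair of vertices: if it is an edge that is not covered, the next digit determines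
which of its ends is chosen, and there must not be more than `t` choices. -/
noncomputable def step (s : Search) (e : ℕ × ℕ) : Search :=
  if adj e.1 e.2 ∧ e.1 ∉ s.chosen ∧ e.2 ∉ s.chosen then
    if s.chosen.card < t then
      if 2 ^ (t - (s.chosen.card + 1)) ≤ s.code then
        ⟨insert e.1 s.chosen, s.code - 2 ^ (t - (s.chosen.card + 1)), s.fail⟩
      else ⟨insert e.2 s.chosen, s.code, s.fail⟩
    else ⟨s.chosen, s.code, true⟩
  else s

variable {adj t}

theorem chosen_subset_step (s : Search) (e : ℕ × ℕ) : s.chosen ⊆ (s.step adj t e).chosen := by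
  unfold step
  split_ifs <;> simp

theorem fail_of_fail_step {s : Search} {e : ℕ × ℕ} (h : (s.step adj t e).fail = false) :
    s.fail = false := by
  unfold step at h
  split_ifs at h <;> simp_all

theorem card_step_le {s : Search} (h : s.chosen.card ≤ t) (e : ℕ × ℕ) :
    (s.step adj t e).chosen.card ≤ t := by
  unfold step
  split_ifs with h₁ h₂ h₃
  · rw [Finset.card_insert_of_notMem h₁.2.1]; omega
  · rw [Finset.card_insert_of_notMem h₁.2.2]; omega
  · exact h
  · exact h

theorem mem_of_step {s : Search} {e : ℕ × ℕ} (h : (s.step adj t e).fail = false)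
    (he : adj e.1 e.2) :
    e.1 ∈ (s.step adj t e).chosen ∨ e.2 ∈ (s.step adj t e).chosen := by
  unfold step at h ⊢
  split_ifs at h ⊢ with h₁ h₂ h₃
  · simp
  · simp
  · by_contra hn
    push Not at hn
    exact h₁ ⟨he, hn⟩

/-- The set of chosen vertices only grows and a failure is never revoked. So in a successful run
each edge was covered when it was treated and stays covered. -/
theorem sound (es : List (ℕ × ℕ)) {s : Search} (hc : s.chosen.card ≤ t)
    (h : (es.foldl (step adj t) s).fail = false) :
    s.fail = false ∧ s.chosen ⊆ (es.foldl (step adj t) s).chosen ∧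
      (es.foldl (step adj t) s).chosen.card ≤ t ∧
      ∀ e ∈ es, adj e.1 e.2 → e.1 ∈ (es.foldl (step adj t) s).chosen ∨
        e.2 ∈ (es.foldl (step adj t) s).chosen := by
  induction es generalizing s with
  | nil => exact ⟨h, subset_rfl, hc, by simp⟩
  | cons e es ih =>
    obtain ⟨h₁, h₂, h₃, h₄⟩ := ih (card_step_le hc e) h
    refine ⟨fail_of_fail_step h₁, (chosen_subset_step s e).trans h₂, h₃, ?_⟩
    rw [List.forall_mem_cons]
    exact ⟨fun he => (mem_of_step h₁ he).imp (fun h => h₂ h) (fun h => h₂ h), h₄⟩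

/-- The code is built backwards: at each uncovered edge its leading digit points to an end in `X`,
so the chosen set stays inside `X` and the digits suffice. -/
theorem complete (es : List (ℕ × ℕ)) {X : Finset ℕ} (hX : X.card ≤ t)
    (hcov : ∀ e ∈ es, adj e.1 e.2 → e.1 ∈ X ∨ e.2 ∈ X) {A : Finset ℕ} (hA : A ⊆ X) :
    ∃ c < 2 ^ (t - A.card), (es.foldl (step adj t) ⟨A, c, false⟩).fail = false := by
  induction es generalizing A with
  | nil => exact ⟨0, by positivity, rfl⟩
  | cons e es ih =>
    rw [List.forall_mem_cons] at hcov
    by_cases he : adj e.1 e.2 ∧ e.1 ∉ A ∧ e.2 ∉ A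
    · have choose {x : ℕ} (hx : x ∈ X) (hxA : x ∉ A) : A.card < t ∧ ∃ c <
          2 ^ (t - (A.card + 1)), (es.foldl (step adj t) ⟨insert x A, c, false⟩).fail = false := by
        have hsub : insert x A ⊆ X := Finset.insert_subset hx hA
        have hcard := Finset.card_le_card hsub
        have := ih hcov.2 hsub
        rw [Finset.card_insert_of_notMem hxA] at hcard this
        exact ⟨by omega, this⟩
      have hpow (h : A.card < t) : 2 ^ (t - A.card) = 2 * 2 ^ (t - (A.card + 1)) := by
        rw [← pow_succ']
        congr 1
        omega
      by_cases h1 : e.1 ∈ X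
      · obtain ⟨hlt, c, hc, hf⟩ := choose h1 he.2.1
        -- A leading digit `1` selects the first end; below, a leading digit `0` selects the second
        -- one.
        refine ⟨c + 2 ^ (t - (A.card + 1)), by rw [hpow hlt]; omega, ?_⟩
        simpa [step, he, hlt] using hf
      · obtain ⟨hlt, c, hc, hf⟩ := choose ((hcov.1 he.1).resolve_left h1) he.2.2
        refine ⟨c, by rw [hpow hlt]; omega, ?_⟩
        simpa [step, he, hlt, not_le.2 hc] using hf
    · obtain ⟨c, hc, hf⟩ := ih hcov.2 hA
      exact ⟨c, hc, by simpa [step, he] using hf⟩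

/-- A set of at most `t` numbers meets all edges in a list if and only if one of the searches
succeeds. -/
theorem exists_code_iff (es : List (ℕ × ℕ)) :
    (∃ c < 2 ^ t, (es.foldl (step adj t) ⟨∅, c, false⟩).fail = false) ↔
      ∃ X : Finset ℕ, X.card ≤ t ∧ ∀ e ∈ es, adj e.1 e.2 → e.1 ∈ X ∨ e.2 ∈ X := by
  constructor
  · rintro ⟨c, -, h⟩
    obtain ⟨-, -, h₁, h₂⟩ := sound es (by simp) h
    exact ⟨_, h₁, h₂⟩
  · rintro ⟨X, hX, hcov⟩
    simpa using complete es hX hcov (Finset.empty_subset X)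

end Search

/-- The pairs whose first entry is less than `i`, and the pairs with first entry `i` whose second
entry is less than `j`. -/
def pairs (n i j : ℕ) : List (ℕ × ℕ) :=
  ((List.range i).flatMap fun u => (List.range n).map fun v => (u, v)) ++
    (List.range j).map fun v => (i, v)

theorem pairs_succ_right (n i j : ℕ) : pairs n i (j + 1) = pairs n i j ++ [(i, j)] := by
  simp [pairs, List.range_succ]

/-- The end of an inner loop is the start of the next pass of the outer loop. -/
theorem pairs_succ_left (n i : ℕ) : pairs n (i + 1) 0 = pairs n i n := by
  simp [pairs, List.range_succ]

namespace Instance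

variable (I : Instance)

/-- The search for a vertex cover of size at most the budget that is determined by the number `c`,
after the treatment of the pairs before `(i, j)`. -/
noncomputable def search (c i j : ℕ) : Search :=
  (pairs I.n i j).foldl (Search.step I.AdjNat I.budget) ⟨∅, c, false⟩

theorem vcn_le_budget_iff :
    I.vcn ≤ I.budget ↔ ∃ c < 2 ^ I.budget, (I.search c I.n 0).fail = false := by
  classical
  simp only [search, Search.exists_code_iff]
  constructor
  · intro h
    obtain ⟨U, hU, hcard⟩ := I.exists_isVertexCover_card_eq_vcn
    refine ⟨U.image Fin.val, Finset.card_image_le.trans (hcard.trans_le h), ?_⟩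
    rintro e - ⟨h₁, h₂, he⟩
    exact (hU he).imp (fun h => Finset.mem_image_of_mem _ h) (fun h => Finset.mem_image_of_mem _ h)
  · rintro ⟨X, hX, hcov⟩
    refine (I.vcn_le_card (U := {v | (v : ℕ) ∈ X}) fun u v huv => ?_).trans (le_trans ?_ hX)
    · have := hcov (u, v) (by simp [pairs]) ⟨u.isLt, v.isLt, huv⟩
      simpa using this
    · exact Finset.card_le_card_of_injOn Fin.val (fun v hv => by simpa using hv)
        Fin.val_injective.injOn

end Instance

/-! ### Programs that test for an easy instance. -/

open RAM Instance

namespace Program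

/-- Computes powers of two up to the budget, which is put into register `4`. -/
def powers : Prog :=
  .seq (.assign 4 (.const 0)) <|
  .seq (.write 2 (.const 0) (.const 1)) <|
  .forLoop 12 2 <|
    .cond (.sub (.add (.reg 1) (.const 1)) (.add (.get 2 (.reg 4)) (.get 2 (.reg 4))))
      (.seq (.write 2 (.add (.reg 4) (.const 1)) (.add (.get 2 (.reg 4)) (.get 2 (.reg 4))))
        (.assign 4 (.add (.reg 4) (.const 1))))
      .skip

/-- Each of the `k` passes raises the exponent by one unless the next power of two would exceed `n`,
so after `i` passes it is `min i (log₂ n)`. -/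
theorem runs_powers {I : Instance} {m : Memory} (hm : Ready I m) :
    Runs (bitSize I.encode) powers m fun m' =>
      m'.reg 4 = I.budget ∧ ∀ j ≤ I.budget, m'.arr 2 j = 2 ^ j := by
  refine .seq (.assign (.seq (.write ?_)))
  refine (Runs.forLoop (fun i m => m.reg 4 = min i (Nat.log 2 I.n) ∧
    ∀ j ≤ min i (Nat.log 2 I.n), m.arr 2 j = 2 ^ j) ?_ I.k_le_bitSize (by decide) (by decide)
    (by decide) ?_ ?_ ?_)
  · simp [hm.k_eq]
  · exact fun _ _ _ h => ⟨by simpa using h.1, h.2⟩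
  · simp [Term.eval]
  · rintro i hi m' ⟨h4, hP⟩ - hf
    have h1 : m'.reg 1 = I.n := by
      rw [hf.reg 1 (by decide)]
      simp [hm.n_eq]
    have hlog : 2 ^ (min i (Nat.log 2 I.n) + 1) ≤ I.n ↔ i < Nat.log 2 I.n := by
      rw [← Nat.le_log_iff_pow_le one_lt_two (by have := I.n_pos; omega)]
      omega
    refine .cond (fun he => .seq (.write (.assign ?_))) fun he => .skip ?_
    all_goals
      simp only [Term.eval, h1, h4, hP _ le_rfl, ← two_mul, ← pow_succ'] at he
    · have hlt : i < Nat.log 2 I.n := hlog.1 (by omega)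
      rw [min_eq_left hlt.le] at hP h4
      rw [min_eq_left (Nat.succ_le_of_lt hlt)]
      refine ⟨by simp [Term.eval, h4], fun j hj => ?_⟩
      simp only [Term.eval, Memory.arr_setReg, Memory.arr_setArr, true_and, h4, hP i le_rfl]
      split_ifs with h
      · rw [h, pow_succ', two_mul]
      · exact hP j (by omega)
    · have hle : Nat.log 2 I.n ≤ i := not_lt.1 fun h => by
        have := hlog.2 h
        omega
      rw [min_eq_right hle] at hP h4
      rw [min_eq_right (hle.trans (Nat.le_succ i))]
      exact ⟨h4, hP⟩

/-- Treats one pair in the search for a vertex cover. -/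
def searchStep : Prog :=
  .cond (.sub (adjTerm (.reg 7) (.reg 8)) (.add (.get 3 (.reg 7)) (.get 3 (.reg 8))))
    (.cond (.sub (.reg 4) (.reg 9))
      (.seq
        (.cond (.sub (.add (.reg 6) (.const 1)) (.get 2 (.sub (.reg 4) (.add (.reg 9) (.const 1)))))
          (.seq (.assign 6 (.sub (.reg 6) (.get 2 (.sub (.reg 4) (.add (.reg 9) (.const 1))))))
            (.write 3 (.reg 7) (.const 1)))
          (.write 3 (.reg 8) (.const 1)))
        (.assign 9 (.add (.reg 9) (.const 1))))
      (.assign 10 (.const 1)))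
    .skip

/-- The search that is determined by the number in register `5`. Register `10` tells whether it
fails. -/
def searchProg : Prog :=
  .seq (.assign 9 (.const 0)) <|
  .seq (.assign 10 (.const 0)) <|
  .seq (.assign 6 (.reg 5)) <|
  .seq (.forLoop 7 1 (.write 3 (.reg 7) (.const 0))) <|
  .forLoop 7 1 (.forLoop 8 1 searchStep)

/-- The budget and the powers of two are available. -/
structure HasPowers (I : Instance) (m : Memory) : Prop extends Ready I m where
  budget_eq : m.reg 4 = I.budget
  pow_eq : ∀ j ≤ I.budget, m.arr 2 j = 2 ^ j

theorem HasPowers.frame {I : Instance} {p : Prog} {m m' : Memory} (h : HasPowers I m)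
    (hf : Frame p m m') (h₁ : 1 ∉ p.regs) (h₂ : 2 ∉ p.regs) (h₃ : 4 ∉ p.regs) (h₄ : 0 ∉ p.arrs)
    (h₅ : 1 ∉ p.arrs) (h₆ : 2 ∉ p.arrs) : HasPowers I m' where
  toReady := h.toReady.frame hf h₁ h₂ h₄ h₅
  budget_eq := (hf.reg 4 h₃).trans h.budget_eq
  pow_eq j hj := by rw [hf.arr 2 h₆]; exact h.pow_eq j hj

/-- The memory holds the state of a search. -/
structure HoldsSearch (n : ℕ) (s : Search) (m : Memory) : Prop where
  chosen_eq : ∀ u < n, m.arr 3 u = if u ∈ s.chosen then 1 else 0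
  card_eq : m.reg 9 = s.chosen.card
  code_eq : m.reg 6 = s.code
  fail_eq : m.reg 10 = s.fail.toNat

theorem runs_searchStep {I : Instance} {N : ℕ} {m : Memory} (hm : HasPowers I m) {s : Search}
    (hs : HoldsSearch I.n s m) {u v : ℕ} (hu : u < I.n) (hv : v < I.n) (h7 : m.reg 7 = u)
    (h8 : m.reg 8 = v) :
    Runs N searchStep m (HoldsSearch I.n (s.step I.AdjNat I.budget (u, v))) := by
  have hadj : (adjTerm (.reg 7) (.reg 8)).eval m = I.bit u v := by
    rw [hm.eval_adjTerm (by simpa [Term.eval, h7]) (by simpa [Term.eval, h8])]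
    simp [Term.eval, h7, h8]
  -- The adjacency bit minus the two marks, truncated at `0`, is nonzero exactly for an uncovered
  -- edge.
  have hcond : (Term.sub (adjTerm (.reg 7) (.reg 8))
      (.add (.get 3 (.reg 7)) (.get 3 (.reg 8)))).eval m ≠ 0 ↔
      I.AdjNat u v ∧ u ∉ s.chosen ∧ v ∉ s.chosen := by
    simp only [Term.eval] at hadj ⊢
    rw [hadj, h7, h8, hs.chosen_eq u hu, hs.chosen_eq v hv, bit]
    split_ifs <;> simp_all
  have hp : m.arr 2 (I.budget - (s.chosen.card + 1)) = 2 ^ (I.budget - (s.chosen.card + 1)) :=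
    hm.pow_eq _ (Nat.sub_le _ _)
  have hb : (Term.sub (.reg 4) (.reg 9)).eval m ≠ 0 ↔ s.chosen.card < I.budget := by
    simp only [Term.eval, hm.budget_eq, hs.card_eq]
    omega
  have hx : (Term.sub (.add (.reg 6) (.const 1))
      (.get 2 (.sub (.reg 4) (.add (.reg 9) (.const 1))))).eval m ≠ 0 ↔
      2 ^ (I.budget - (s.chosen.card + 1)) ≤ s.code := by
    simp only [Term.eval, hm.budget_eq, hs.card_eq, hs.code_eq, hp]
    omega
  unfold Search.step
  refine .cond (fun he => ?_) fun he => ?_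
  · rw [if_pos (hcond.1 he)]
    obtain ⟨-, hu', hv'⟩ := hcond.1 he
    refine .cond (fun he => ?_) fun he => ?_
    · rw [if_pos (hb.1 he)]
      refine .seq (.cond (fun he => ?_) fun he => ?_)
      · rw [if_pos (hx.1 he)]
        refine .seq (.assign (.write (.assign ⟨fun w hw => ?_, ?_, ?_, ?_⟩)))
        · simp [Term.eval, h7, hs.chosen_eq w hw, ite_or]
        · simp [Term.eval, hs.card_eq, Finset.card_insert_of_notMem hu']
        · simp [Term.eval, hm.budget_eq, hs.card_eq, hs.code_eq, hp]
        · simpa using hs.fail_eq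
      · rw [if_neg (mt hx.2 (not_not.2 he))]
        refine .write (.assign ⟨fun w hw => ?_, ?_, ?_, ?_⟩)
        · simp [Term.eval, h8, hs.chosen_eq w hw, ite_or]
        · simp [Term.eval, hs.card_eq, Finset.card_insert_of_notMem hv']
        · simpa using hs.code_eq
        · simpa using hs.fail_eq
    · rw [if_neg (mt hb.2 (not_not.2 he))]
      exact .assign ⟨by simpa using hs.chosen_eq, by simpa using hs.card_eq,
        by simpa using hs.code_eq, by simp [Term.eval]⟩
  · rw [if_neg (mt hcond.2 (not_not.2 he))]
    exact .skip hs

theorem runs_searchProg {I : Instance} {m : Memory} (hm : HasPowers I m) :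
    Runs (bitSize I.encode) searchProg m fun m' =>
      m'.reg 10 = (I.search (m.reg 5) I.n 0).fail.toNat := by
  refine .seq (.assign (.seq (.assign (.seq (.assign ?_)))))
  refine .seq_frame (Runs.forLoop (n := I.n) (fun i m => ∀ u < i, m.arr 3 u = 0)
    (by simpa using hm.n_eq) I.n_le_bitSize (by decide) (by decide) (by decide)
    (fun _ _ _ h => h) (by simp) ?_) ?_
  · intro i hi m' h hi' _
    refine .write fun u hu => ?_
    simp only [Term.eval, Memory.arr_setArr, true_and, hi']
    split_ifs with hui
    · rfl
    · exact h u (by omega)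
  intro m₁ h₁ hf₁
  have hm₁ : HasPowers I m₁ := by
    refine HasPowers.frame ?_ hf₁ (by decide) (by decide) (by decide) (by decide) (by decide)
      (by decide)
    exact ⟨⟨by simpa using hm.n_eq, by simpa using hm.k_eq, hm.row_eq, hm.input_eq⟩,
      by simpa using hm.budget_eq, hm.pow_eq⟩
  have hs₁ : HoldsSearch I.n (I.search (m.reg 5) 0 0) m₁ := by
    refine ⟨fun u hu => ?_, ?_, ?_, ?_⟩
    · simpa [search, pairs] using h₁ u hu
    all_goals
      rw [hf₁.reg _ (by decide)]
      simp [search, pairs, Term.eval]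
  refine Runs.mono (Runs.forLoop (n := I.n)
    (fun i m' => HoldsSearch I.n (I.search (m.reg 5) i 0) m')
    hm₁.n_eq I.n_le_bitSize (by decide) (by decide) (by decide) ?_ hs₁ ?_) fun m' h => h.fail_eq
  · exact fun i m' v h => ⟨h.chosen_eq, by simpa using h.card_eq, by simpa using h.code_eq,
      by simpa using h.fail_eq⟩
  intro i hi m₂ hs₂ h7 hf₂
  have hm₂ := hm₁.frame hf₂ (by decide) (by decide) (by decide) (by decide) (by decide) (by decide)
  have key := Runs.forLoop (n := I.n) (p := searchStep) (x := 8)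
    (fun j m' => HoldsSearch I.n (I.search (m.reg 5) i j) m')
    hm₂.n_eq I.n_le_bitSize (by decide) (by decide) (by decide) ?_ hs₂ ?_
  · simpa only [search, pairs_succ_left] using key
  · exact fun i m' v h => ⟨h.chosen_eq, by simpa using h.card_eq, by simpa using h.code_eq,
      by simpa using h.fail_eq⟩
  intro j hj m₃ hs₃ h8 hf₃
  have hm₃ := hm₂.frame hf₃ (by decide) (by decide) (by decide) (by decide) (by decide) (by decide)
  have h7' : m₃.reg 7 = i := (hf₃.reg 7 (by decide)).trans h7
  simpa only [search, pairs_succ_right, List.foldl_append, List.foldl_cons,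
    List.foldl_nil] using
    runs_searchStep hm₃ hs₃ hi hj h7' h8

/-- Puts a number into register `3` that is not `0` if and only if the instance is easy. -/
def easyTest : Prog :=
  .seq powers <|
  .seq (.assign 3 (.const 0)) <|
  .seq (.assign 11 (.get 2 (.reg 4))) <|
  .seq (.forLoop 5 11 (.seq searchProg (.cond (.reg 10) .skip (.assign 3 (.const 1))))) <|
  .seq (.cond (.sub (.add (.reg 2) (.const 1)) (.reg 1)) (.assign 3 (.const 1)) .skip) <|
  .cond (.reg 2) .skip (.assign 3 (.const 0))

theorem runs_easyTest {I : Instance} {m : Memory} (hm : Ready I m) :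
    Runs (bitSize I.encode) easyTest m fun m' => m'.reg 3 ≠ 0 ↔ I.Easy := by
  refine .seq_frame (runs_powers hm) fun m₁ h₁ hf₁ => .seq (.assign (.seq (.assign ?_)))
  have hm₁ : HasPowers I m₁ :=
    ⟨hm.frame hf₁ (by decide) (by decide) (by decide) (by decide), h₁.1, h₁.2⟩
  set m₂ := (m₁.setReg 3 ((Term.const 0).eval m₁)).setReg 11
    ((Term.get 2 (.reg 4)).eval (m₁.setReg 3 ((Term.const 0).eval m₁)))
  have hm₂ : HasPowers I m₂ :=
    ⟨⟨by simpa [m₂] using hm₁.n_eq, by simpa [m₂] using hm₁.k_eq, hm₁.row_eq, hm₁.input_eq⟩,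
      by simpa [m₂] using hm₁.budget_eq, hm₁.pow_eq⟩
  have h11 : m₂.reg 11 = 2 ^ I.budget := by
    simp [m₂, Term.eval, hm₁.budget_eq, hm₁.pow_eq _ le_rfl]
  -- This is the reason for the logarithm in the budget: the number of searches is at most `n`.
  have hbound : 2 ^ I.budget ≤ bitSize I.encode :=
    (Nat.pow_le_of_le_log (by have := I.n_pos; omega) (min_le_right _ _)).trans I.n_le_bitSize
  refine .seq_frame (Runs.forLoop
    (fun c m' => m'.reg 3 ≠ 0 ↔ ∃ d < c, (I.search d I.n 0).fail = false) h11 hbound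
    (by decide) (by decide) (by decide) ?_ ?_ ?_) ?_
  · exact fun i m' v h => by simpa using h
  · simp [m₂, Term.eval]
  · intro c hc m₃ h₃ h5 hf₃
    have hm₃ := hm₂.frame hf₃ (by decide) (by decide) (by decide) (by decide) (by decide)
      (by decide)
    refine .seq_frame (runs_searchProg hm₃) fun m₄ h₄ hf₄ => ?_
    rw [h5] at h₄
    have hsplit : (∃ d < c + 1, (I.search d I.n 0).fail = false) ↔
        (∃ d < c, (I.search d I.n 0).fail = false) ∨ (I.search c I.n 0).fail = false :=
      Nat.exists_lt_succ_right
    have h3 := hf₄.reg 3 (by decide)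
    refine .cond (fun he => .skip ?_) fun he => .assign ?_
    all_goals
      simp only [Term.eval, h₄] at he
      rw [hsplit]
    · rw [h3, h₃]
      simp_all
    · simp_all [Term.eval]
  · intro m₃ h₃ hf₃
    rw [← I.vcn_le_budget_iff] at h₃
    have hm₃ := hm₂.frame hf₃ (by decide) (by decide) (by decide) (by decide) (by decide)
      (by decide)
    have hk := hm₃.k_eq
    have hn := hm₃.n_eq
    refine .seq (.cond (fun he => .assign ?_) fun he => .skip ?_)
    all_goals
      simp only [Term.eval, hk, hn] at he
      refine .cond (fun hk' => .skip ?_) fun hk' => .assign ?_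
      all_goals simp only [Term.eval, Memory.reg_setReg, hk] at hk'
    · have : I.n ≤ I.k := by omega
      simpa [Term.eval, Easy, this] using Nat.one_le_iff_ne_zero.2 hk'
    · simp_all [Term.eval, Easy]
    · have : ¬ I.n ≤ I.k := by omega
      rw [h₃]
      simp [Easy, this, Nat.one_le_iff_ne_zero.2 hk']
    · simp_all [Term.eval, Easy]

end Program

end CnR

/-! ### The kept vertices and the output as lists of numbers. -/

namespace CnR

namespace Instance

variable (I : Instance)

/-- The number of twins of `v` among the first `i` vertices. -/
noncomputable def twinCount (v i : ℕ) : ℕ :=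
  ((List.range i).filter fun u => ∀ w < I.n, I.bit u w = I.bit v w).length

/-- The list of the kept vertices among the first `i` vertices. -/
noncomputable def keptNat (i : ℕ) : List ℕ :=
  (List.range i).filter fun v => I.twinCount v v ≤ I.k

theorem twins_iff_bit_eq {u v : Fin I.n} :
    Twins I.graph u v ↔ ∀ w < I.n, I.bit u w = I.bit v w := by
  classical
  have hbit (u w : Fin I.n) : I.AdjNat u w ↔ I.graph.Adj u w :=
    ⟨fun ⟨_, _, h⟩ => h, fun h => ⟨u.isLt, w.isLt, h⟩⟩
  have key (w : Fin I.n) : I.bit u w = I.bit v w ↔ (I.graph.Adj u w ↔ I.graph.Adj v w) := by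
    rw [bit, bit, ← hbit, ← hbit]
    split_ifs <;> simp_all
  constructor
  · exact fun h w hw => (key ⟨w, hw⟩).2 h.adj_iff
  · intro h
    ext w
    simpa using (key w).1 (h w w.isLt)

theorem twinCount_eq_card (v : Fin I.n) : I.twinCount v v = (I.twinsBefore v).card := by
  classical
  rw [twinCount, ← List.toFinset_card_of_nodup (List.nodup_range.filter _),
    ← Finset.card_map Fin.valEmbedding]
  congr 1
  ext u
  simp only [List.mem_toFinset, List.mem_filter, List.mem_range, decide_eq_true_eq,
    Finset.mem_map, twinsBefore, Finset.mem_filter, Finset.mem_univ, true_and,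
    Fin.valEmbedding_apply]
  constructor
  · rintro ⟨hu, h⟩
    exact ⟨⟨u, hu.trans v.isLt⟩, ⟨hu, I.twins_iff_bit_eq.2 h⟩, rfl⟩
  · rintro ⟨u, ⟨hu, h⟩, rfl⟩
    exact ⟨hu, I.twins_iff_bit_eq.1 h⟩

theorem keptNat_eq : I.keptNat I.n = I.kept.map Fin.val := by
  classical
  rw [keptNat, ← List.map_coe_finRange_eq_range, List.filter_map, kept]
  congr 1
  refine List.filter_congr fun v _ => decide_eq_decide.2 ?_
  rw [Keeps, twinCount_eq_card]

theorem length_keptNat : (I.keptNat I.n).length = I.kept.length := by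
  simp [keptNat_eq]

theorem keptNat_lt {i : ℕ} (h : i < (I.keptNat I.n).length) : (I.keptNat I.n)[i] < I.n :=
  List.mem_range.1 (List.mem_of_mem_filter (List.getElem_mem h))

theorem twinCount_succ (v i : ℕ) :
    I.twinCount v (i + 1) =
      I.twinCount v i + if ∀ w < I.n, I.bit i w = I.bit v w then 1 else 0 := by
  rw [twinCount, List.range_succ, List.filter_append, List.length_append, ← twinCount]
  simp only [List.filter_cons, List.filter_nil, decide_eq_true_eq]
  split_ifs <;> rfl

theorem keptNat_succ (i : ℕ) :
    I.keptNat (i + 1) = I.keptNat i ++ if I.twinCount i i ≤ I.k then [i] else [] := by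
  rw [keptNat, List.range_succ, List.filter_append, ← keptNat]
  congr 1
  split_ifs with h <;> simp [h]

/-- The numbers in the description of a cop whose speed and reach are lowered to at most `b`. -/
def clampedCopEntries (b i : ℕ) : List ℕ :=
  [min ((I.copEntries i).getD 0 0) b, min ((I.copEntries i).getD 1 0) b, (I.copEntries i).getD 2 0]

/-- The output is expressed by the entries of the input and the list of kept vertices, in the order
in which the machine writes it. -/
theorem encode_reduce : I.reduce.encode =
    [I.kept.length] ++ ((List.range I.kept.length).flatMap fun u =>
      (List.range I.kept.length).map fun v =>
        I.bit ((I.keptNat I.n).getD u 0) ((I.keptNat I.n).getD v 0)) ++ [I.k] ++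
      (List.range I.k).flatMap (I.clampedCopEntries I.kept.length) ++
      [min I.robber.speed I.kept.length, statusCode I.robber.status] := by
  have hadj (u v : ℕ) (hu : u < I.kept.length) (hv : v < I.kept.length) : I.reduce.bit u v =
      I.bit ((I.keptNat I.n).getD u 0) ((I.keptNat I.n).getD v 0) := by
    have h : I.reduce.AdjNat u v ↔
        I.AdjNat ((I.keptNat I.n).getD u 0) ((I.keptNat I.n).getD v 0) := by
      rw [keptNat_eq, List.getD_eq_getElem _ _ (by simpa), List.getD_eq_getElem _ _ (by simpa)]
      simp only [List.getElem_map]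
      exact ⟨fun ⟨_, _, h⟩ => ⟨Fin.isLt _, Fin.isLt _, h⟩, fun ⟨_, _, h⟩ => ⟨hu, hv, h⟩⟩
    rw [bit, bit, propext h]
  have hcop (i : ℕ) (hi : i < I.k) :
      I.reduce.copEntries i = I.clampedCopEntries I.kept.length i := by
    have hi' : i < I.reduce.k := hi
    simp only [clampedCopEntries, copEntries, dif_pos hi, dif_pos hi']
    rfl
  rw [encode_eq]
  congr 1
  congr 1
  · congr 1
    congr 1
    refine List.flatMap_congr fun u hu => List.map_congr_left fun v hv => ?_
    exact hadj u v (List.mem_range.1 hu) (List.mem_range.1 hv)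
  · exact List.flatMap_congr fun i hi => hcop i (List.mem_range.1 hi)

theorem encode_trivialYes : trivialYes.encode = [1, 0, 1, 1, 0, 2, 0, 2] := by
  simp [encode_eq, bit, AdjNat, copEntries, trivialYes, statusCode]

/-- Needed as the bound on the number of passes of the loop that copies the output. -/
theorem length_encode_reduce_le : I.reduce.encode.length ≤ RAM.bitSize I.encode := by
  refine le_trans ?_ (length_le_bitSize _)
  rw [length_encode, length_encode]
  have h : I.reduce.n ≤ I.n := I.length_kept_le
  have := Nat.mul_le_mul h h
  have h' : I.reduce.k = I.k := rfl
  omega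

end Instance

/-! ### Programs that write the output. -/

open RAM Instance

namespace Program

/-- The list `l` is in array `a` and its length is in register `x`. -/
def Holds (a x : ℕ) (l : List ℕ) (m : Memory) : Prop :=
  m.reg x = l.length ∧ ∀ i < l.length, m.arr a i = l.getD i 0

theorem Holds.frame {a x : ℕ} {l : List ℕ} {p : Prog} {m m' : Memory} (h : Holds a x l m)
    (hf : Frame p m m') (hx : x ∉ p.regs) (ha : a ∉ p.arrs) : Holds a x l m' :=
  ⟨(hf.reg x hx).trans h.1, fun i hi => by rw [hf.arr a ha]; exact h.2 i hi⟩

theorem Holds.setReg {a x y v : ℕ} {l : List ℕ} {m : Memory} (h : Holds a x l m) (hxy : x ≠ y) :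
    Holds a x l (m.setReg y v) :=
  ⟨by simpa [hxy] using h.1, h.2⟩

/-- Appends a number to the list in array `a` with length in register `x`. -/
def push (a x : ℕ) (e : Term) : Prog :=
  .seq (.write a (.reg x) e) (.assign x (.add (.reg x) (.const 1)))

theorem runs_push {N a x : ℕ} {e : Term} {l : List ℕ} {m : Memory} (h : Holds a x l m) {v : ℕ}
    (hv : e.eval m = v) : Runs N (push a x e) m (Holds a x (l ++ [v])) := by
  refine .seq (.write (.assign ⟨by simp [Term.eval, h.1], fun i hi => ?_⟩))
  simp only [List.length_append, List.length_singleton] at hi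
  simp only [Memory.arr_setReg, Memory.arr_setArr, true_and, Term.eval, h.1, hv]
  split_ifs with hil
  · simp [hil]
  · rw [List.getD_append _ _ _ _ (by omega)]
    exact h.2 i (by omega)

/-- Makes the list of the kept vertices in array `4`. -/
def listKept : Prog :=
  .seq (.assign 13 (.const 0)) <|
  .forLoop 8 1 <|
    .seq (.assign 14 (.const 0)) <|
    .seq (.forLoop 7 8 <|
      .seq (.assign 15 (.const 1)) <|
      .seq (.forLoop 16 1 <|
        -- The sum of the two truncated differences is the distance of the two bits, so it is
        -- nonzero exactly if the rows differ here.
        .cond (.add (.sub (adjTerm (.reg 7) (.reg 16)) (adjTerm (.reg 8) (.reg 16)))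
            (.sub (adjTerm (.reg 8) (.reg 16)) (adjTerm (.reg 7) (.reg 16))))
          (.assign 15 (.const 0)) .skip) <|
      .assign 14 (.add (.reg 14) (.reg 15))) <|
    .cond (.sub (.add (.reg 2) (.const 1)) (.reg 14)) (push 4 13 (.reg 8)) .skip

theorem runs_listKept {I : Instance} {m : Memory} (hm : Ready I m) :
    Runs (bitSize I.encode) listKept m (Holds 4 13 (I.keptNat I.n)) := by
  refine .seq (.assign ?_)
  have hm₀ : Ready I (m.setReg 13 ((Term.const 0).eval m)) :=
    ⟨by simpa using hm.n_eq, by simpa using hm.k_eq, hm.row_eq, hm.input_eq⟩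
  refine Runs.forLoop (fun v m' => Holds 4 13 (I.keptNat v) m') hm₀.n_eq I.n_le_bitSize (by decide)
    (by decide) (by decide) (fun _ _ _ h => h.setReg (by decide)) ⟨by simp [keptNat, Term.eval],
    by simp [keptNat]⟩ ?_
  intro v hv m₁ h₁ h8 hf₁
  have hm₁ := hm₀.frame hf₁ (by decide) (by decide) (by decide) (by decide)
  refine .seq (.assign ?_)
  set m₂ := m₁.setReg 14 ((Term.const 0).eval m₁)
  have hm₂ : Ready I m₂ :=
    ⟨by simpa [m₂] using hm₁.n_eq, by simpa [m₂] using hm₁.k_eq, hm₁.row_eq, hm₁.input_eq⟩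
  have h8₂ : m₂.reg 8 = v := by simpa [m₂] using h8
  refine .seq_frame (Runs.forLoop (fun u m' => m'.reg 14 = I.twinCount v u) h8₂
    (hv.le.trans I.n_le_bitSize) (by decide) (by decide) (by decide) ?_ ?_ ?_) ?_
  · exact fun _ _ _ h => by simpa using h
  · simp [m₂, Term.eval, twinCount]
  · intro u hu m₃ h₃ h7 hf₃
    have hm₃ := hm₂.frame hf₃ (by decide) (by decide) (by decide) (by decide)
    have h8₃ : m₃.reg 8 = v := (hf₃.reg 8 (by decide)).trans h8₂
    refine .seq (.assign ?_)
    set m₄ := m₃.setReg 15 ((Term.const 1).eval m₃)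
    have hm₄ : Ready I m₄ :=
      ⟨by simpa [m₄] using hm₃.n_eq, by simpa [m₄] using hm₃.k_eq, hm₃.row_eq, hm₃.input_eq⟩
    refine .seq_frame (Runs.forLoop
      (fun j m' => m'.reg 15 = if ∀ w < j, I.bit u w = I.bit v w then 1 else 0) hm₄.n_eq
      I.n_le_bitSize (by decide) (by decide) (by decide) ?_ ?_ ?_) ?_
    · exact fun _ _ _ h => by simpa using h
    · simp [m₄, Term.eval]
    · intro w hw m₅ h₅ h16 hf₅
      have hm₅ := hm₄.frame hf₅ (by decide) (by decide) (by decide) (by decide)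
      have h7₅ : m₅.reg 7 = u := by rw [hf₅.reg 7 (by decide)]; simpa [m₄] using h7
      have h8₅ : m₅.reg 8 = v := by rw [hf₅.reg 8 (by decide)]; simpa [m₄] using h8₃
      have hu' : u < I.n := hu.trans hv
      have e₁ : (adjTerm (.reg 7) (.reg 16)).eval m₅ = I.bit u w := by
        rw [hm₅.eval_adjTerm (by simpa [Term.eval, h7₅]) (by simpa [Term.eval, h16])]
        simp [Term.eval, h7₅, h16]
      have e₂ : (adjTerm (.reg 8) (.reg 16)).eval m₅ = I.bit v w := by
        rw [hm₅.eval_adjTerm (by simpa [Term.eval, h8₅]) (by simpa [Term.eval, h16])]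
        simp [Term.eval, h8₅, h16]
      have hsplit : (∀ x < w + 1, I.bit u x = I.bit v x) ↔
          (∀ x < w, I.bit u x = I.bit v x) ∧ I.bit u w = I.bit v w :=
        Nat.forall_lt_succ_right
      simp only [hsplit]
      refine .cond (fun he => .assign ?_) fun he => .skip ?_
      all_goals rw [Term.eval, Term.eval, Term.eval, e₁, e₂] at he
      · have : I.bit u w ≠ I.bit v w := by omega
        simp [this, Term.eval]
      · have : I.bit u w = I.bit v w := by omega
        simpa [this] using h₅
    · intro m₅ h₅ hf₅
      have h14 : m₅.reg 14 = I.twinCount v u := by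
        rw [hf₅.reg 14 (by decide)]
        simpa [m₄] using h₃
      refine .assign ?_
      rw [twinCount_succ]
      simp [Term.eval, h14, h₅]
  · intro m₃ h₃ hf₃
    have hm₃ := hm₂.frame hf₃ (by decide) (by decide) (by decide) (by decide)
    have h8₃ : m₃.reg 8 = v := (hf₃.reg 8 (by decide)).trans h8₂
    have hh : Holds 4 13 (I.keptNat v) m₃ :=
      (h₁.setReg (by decide) : Holds 4 13 _ m₂).frame hf₃ (by decide) (by decide)
    rw [keptNat_succ]
    refine .cond (fun he => ?_) fun he => .skip ?_
    all_goals simp only [Term.eval, hm₃.k_eq, h₃] at he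
    · rw [if_pos (by omega)]
      exact runs_push hh h8₃
    · rw [if_neg (by omega)]
      simpa using hh

/-- The smaller one of two numbers. -/
def minTerm (e f : Term) : Term :=
  .sub e (.sub e f)

theorem eval_minTerm (e f : Term) (m : Memory) :
    (minTerm e f).eval m = min (e.eval m) (f.eval m) := by
  simp only [minTerm, Term.eval]
  omega

/-- Makes the encoding of the reduced instance in array `5`. -/
def makeOutput : Prog :=
  .seq (.assign 17 (.const 0)) <|
  .seq (push 5 17 (.reg 13)) <|
  .seq (.forLoop 7 13 <| .forLoop 8 13 <|
    push 5 17 (adjTerm (.get 4 (.reg 7)) (.get 4 (.reg 8)))) <|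
  .seq (push 5 17 (.reg 2)) <|
  -- Register `18` walks through the input; it starts just after the number of cops, at position `2
  -- + n * n`.
  .seq (.assign 18 (.add (.get 1 (.reg 1)) (.const 1))) <|
  .seq (.forLoop 12 2 <|
    .seq (push 5 17 (minTerm (.get 0 (.reg 18)) (.reg 13))) <|
    .seq (push 5 17 (minTerm (.get 0 (.add (.reg 18) (.const 1))) (.reg 13))) <|
    .seq (push 5 17 (.get 0 (.add (.reg 18) (.const 2)))) <|
    .assign 18 (.add (.reg 18) (.const 3))) <|
  .seq (push 5 17 (minTerm (.get 0 (.reg 18)) (.reg 13))) <|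
  push 5 17 (.get 0 (.add (.reg 18) (.const 1)))

/-- The input and the list of the kept vertices are available. -/
structure HasKept (I : Instance) (m : Memory) : Prop extends Ready I m where
  kept_eq : Holds 4 13 (I.keptNat I.n) m

theorem HasKept.length_eq {I : Instance} {m : Memory} (h : HasKept I m) :
    m.reg 13 = I.kept.length :=
  h.kept_eq.1.trans I.length_keptNat

theorem HasKept.frame {I : Instance} {p : Prog} {m m' : Memory} (h : HasKept I m)
    (hf : Frame p m m') (h₁ : 1 ∉ p.regs) (h₂ : 2 ∉ p.regs) (h₃ : 13 ∉ p.regs) (h₄ : 0 ∉ p.arrs)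
    (h₅ : 1 ∉ p.arrs) (h₆ : 4 ∉ p.arrs) : HasKept I m' :=
  ⟨h.toReady.frame hf h₁ h₂ h₄ h₅, h.kept_eq.frame hf h₃ h₆⟩

theorem HasKept.setReg {I : Instance} {m : Memory} (h : HasKept I m) {x v : ℕ} (h₁ : 1 ≠ x)
    (h₂ : 2 ≠ x) (h₃ : 13 ≠ x) : HasKept I (m.setReg x v) :=
  ⟨⟨by simpa [h₁] using h.n_eq, by simpa [h₂] using h.k_eq, h.row_eq, h.input_eq⟩,
    h.kept_eq.setReg h₃⟩

theorem runs_makeOutput {I : Instance} {m : Memory} (hm : HasKept I m) :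
    Runs (bitSize I.encode) makeOutput m (Holds 5 17 I.reduce.encode) := by
  have hkept : I.kept.length ≤ bitSize I.encode := I.length_kept_le.trans I.n_le_bitSize
  refine .seq (.assign ?_)
  have hm₀ : HasKept I (m.setReg 17 ((Term.const 0).eval m)) :=
    hm.setReg (by decide) (by decide) (by decide)
  refine .seq_frame (runs_push (l := []) ⟨by simp [Term.eval], by simp⟩ hm₀.length_eq)
    fun m₁ h₁ hf₁ => ?_
  have hm₁ := hm₀.frame hf₁ (by decide) (by decide) (by decide) (by decide) (by decide) (by decide)
  let row (u j : ℕ) : List ℕ := (List.range j).map fun v =>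
    I.bit ((I.keptNat I.n).getD u 0) ((I.keptNat I.n).getD v 0)
  refine .seq_frame (Runs.forLoop (fun i m' => Holds 5 17 ([I.kept.length] ++
    (List.range i).flatMap fun u => row u I.kept.length) m') hm₁.length_eq hkept (by decide)
    (by decide) (by decide) (fun _ _ _ h => h.setReg (by decide)) h₁ ?_) fun m₂ h₂ hf₂ => ?_
  · intro u hu m₂ h₂ h7 hf₂
    have hm₂ := hm₁.frame hf₂ (by decide) (by decide) (by decide) (by decide) (by decide)
      (by decide)
    refine Runs.mono (Runs.forLoop (fun j m' => Holds 5 17 (([I.kept.length] ++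
      (List.range u).flatMap fun u => row u I.kept.length) ++ row u j) m') hm₂.length_eq hkept
      (by decide) (by decide) (by decide) (fun _ _ _ h => h.setReg (by decide))
      (by simpa [row] using h₂) ?_) fun m' h => ?_
    · intro v hv m₃ h₃ h8 hf₃
      have hm₃ := hm₂.frame hf₃ (by decide) (by decide) (by decide) (by decide) (by decide)
        (by decide)
      have h7₃ : m₃.reg 7 = u := (hf₃.reg 7 (by decide)).trans h7
      have hlen := I.length_keptNat
      have e₁ : (Term.get 4 (.reg 7)).eval m₃ = (I.keptNat I.n).getD u 0 := by
        simp only [Term.eval, h7₃]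
        exact hm₃.kept_eq.2 u (by omega)
      have e₂ : (Term.get 4 (.reg 8)).eval m₃ = (I.keptNat I.n).getD v 0 := by
        simp only [Term.eval, h8]
        exact hm₃.kept_eq.2 v (by omega)
      have hlt (w : ℕ) (hw : w < I.kept.length) : (I.keptNat I.n).getD w 0 < I.n := by
        rw [List.getD_eq_getElem _ _ (by omega)]
        exact I.keptNat_lt _
      have := runs_push (N := bitSize I.encode) h₃
        (hm₃.eval_adjTerm (e₁ ▸ hlt u hu) (e₂ ▸ hlt v hv))
      rw [e₁, e₂] at this
      simpa only [row, List.range_succ, List.map_append, List.map_cons, List.map_nil,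
        List.append_assoc] using this
    · simpa only [List.range_succ, List.flatMap_append, List.append_assoc, List.flatMap_singleton]
        using h
  have hm₂ := hm₁.frame hf₂ (by decide) (by decide) (by decide) (by decide) (by decide) (by decide)
  refine .seq_frame (runs_push h₂ hm₂.k_eq) fun m₃ h₃ hf₃ => .seq (.assign ?_)
  have hm₃ := hm₂.frame hf₃ (by decide) (by decide) (by decide) (by decide) (by decide) (by decide)
  set m₄ := m₃.setReg 18 ((Term.add (.get 1 (.reg 1)) (.const 1)).eval m₃)
  have hm₄ : HasKept I m₄ := hm₃.setReg (by decide) (by decide) (by decide)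
  have h18 : m₄.reg 18 = 2 + I.n * I.n + 0 * 3 := by
    simp [m₄, Term.eval, hm₃.n_eq, hm₃.row_eq _ le_rfl]
    ring
  refine .seq_frame (Runs.forLoop (fun i m' => Holds 5 17 ([I.kept.length] ++
    ((List.range I.kept.length).flatMap fun u => row u I.kept.length) ++ [I.k] ++
    (List.range i).flatMap (I.clampedCopEntries I.kept.length)) m' ∧
    m'.reg 18 = 2 + I.n * I.n + i * 3) hm₄.k_eq I.k_le_bitSize (by decide) (by decide) (by decide)
    ?_ ?_ ?_) fun m₅ h₅ hf₅ => ?_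
  · exact fun _ _ _ h => ⟨h.1.setReg (by decide), by simpa using h.2⟩
  · exact ⟨by simpa using (h₃.setReg (by decide) : Holds 5 17 _ m₄), h18⟩
  · rintro i hi m₅ ⟨h₅, h18₅⟩ - hf₅
    have hm₅ := hm₄.frame hf₅ (by decide) (by decide) (by decide) (by decide) (by decide)
      (by decide)
    refine .seq_frame (runs_push (v := min ((I.copEntries i).getD 0 0) I.kept.length) h₅ ?_)
      fun m₆ h₆ hf₆ => ?_
    · rw [eval_minTerm]
      simp only [Term.eval, hm₅.length_eq, h18₅, hm₅.input_eq]
      rw [← I.encode_getD_cop hi (by decide), add_zero]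
    have hm₆ := hm₅.frame hf₆ (by decide) (by decide) (by decide) (by decide) (by decide)
      (by decide)
    have h18₆ := (hf₆.reg 18 (by decide)).trans h18₅
    refine .seq_frame (runs_push (v := min ((I.copEntries i).getD 1 0) I.kept.length) h₆ ?_)
      fun m₇ h₇ hf₇ => ?_
    · rw [eval_minTerm]
      simp only [Term.eval, hm₆.length_eq, h18₆, hm₆.input_eq]
      rw [← I.encode_getD_cop hi (by decide)]
    have hm₇ := hm₆.frame hf₇ (by decide) (by decide) (by decide) (by decide) (by decide)
      (by decide)
    have h18₇ := (hf₇.reg 18 (by decide)).trans h18₆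
    refine .seq_frame (runs_push (v := (I.copEntries i).getD 2 0) h₇ ?_)
      fun m₈ h₈ hf₈ => ?_
    · simp only [Term.eval, h18₇, hm₇.input_eq]
      rw [← I.encode_getD_cop hi (by decide)]
    have h18₈ := (hf₈.reg 18 (by decide)).trans h18₇
    refine .assign ⟨Holds.setReg ?_ (by decide), ?_⟩
    · simpa only [List.range_succ, List.flatMap_append, List.append_assoc, List.flatMap_singleton,
        clampedCopEntries, List.singleton_append, List.cons_append, List.nil_append] using h₈
    · simp [Term.eval, h18₈]
      ring
  · have hm₅ := hm₄.frame hf₅ (by decide) (by decide) (by decide) (by decide) (by decide)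
      (by decide)
    obtain ⟨h₅, h18₅⟩ := h₅
    refine .seq_frame (runs_push (v := min I.robber.speed I.kept.length) h₅ ?_)
      fun m₆ h₆ hf₆ => ?_
    · rw [eval_minTerm]
      simp only [Term.eval, hm₅.length_eq, h18₅, hm₅.input_eq]
      have := I.encode_getD_robber (j := 0)
      rw [add_zero] at this
      rw [this]
      rfl
    have hm₆ := hm₅.frame hf₆ (by decide) (by decide) (by decide) (by decide) (by decide)
      (by decide)
    have h18₆ := (hf₆.reg 18 (by decide)).trans h18₅
    refine (runs_push (v := statusCode I.robber.status) h₆ ?_).mono fun m' h => ?_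
    · simp only [Term.eval, h18₆, hm₆.input_eq, encode_getD_robber]
      rfl
    · rw [encode_reduce]
      simpa only [List.append_assoc, List.singleton_append] using h

/-- Copies the list in array `5` to array `0`. -/
def copyOutput : Prog :=
  .seq (.forLoop 12 17 (.write 0 (.reg 12) (.get 5 (.reg 12)))) (.assign 0 (.reg 17))

theorem runs_copyOutput {N : ℕ} {l : List ℕ} {m : Memory} (h : Holds 5 17 l m)
    (hN : l.length ≤ N) : Runs N copyOutput m fun m' => Output m' l := by
  refine .seq_frame (Runs.forLoop (fun i m' => ∀ j < i, m'.arr 0 j = l.getD j 0) h.1 hN (by decide)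
    (by decide) (by decide) (fun _ _ _ h => h) (by simp) ?_) fun m' h' hf => .assign ?_
  · intro i hi m' h' hi' hf
    refine .write fun j hj => ?_
    simp only [Memory.arr_setArr, true_and, Term.eval, hi']
    split_ifs with hji
    · rw [hf.arr 5 (by decide), hji]
      exact h.2 i hi
    · exact h' j (by omega)
  · refine ⟨by simpa [Term.eval, hf.reg 17 (by decide)] using h.1, fun i hi => ?_⟩
    rw [← List.getD_eq_getElem l 0 hi]
    exact h' i hi

/-- Writes the encoding of the trivial yes-instance. -/
def writeTrivialYes : Prog :=
  .seq (.assign 0 (.const 0)) <|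
  .seq (push 0 0 (.const 1)) <|
  .seq (push 0 0 (.const 0)) <|
  .seq (push 0 0 (.const 1)) <|
  .seq (push 0 0 (.const 1)) <|
  .seq (push 0 0 (.const 0)) <|
  .seq (push 0 0 (.const 2)) <|
  .seq (push 0 0 (.const 0)) <|
  push 0 0 (.const 2)

theorem runs_writeTrivialYes {N : ℕ} {m : Memory} :
    Runs N writeTrivialYes m fun m' => Output m' trivialYes.encode := by
  have h₀ : Holds 0 0 [] (m.setReg 0 ((Term.const 0).eval m)) := ⟨by simp [Term.eval], by simp⟩
  rw [encode_trivialYes]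
  refine .seq (.assign ?_)
  refine .seq ((runs_push h₀ rfl).mono fun _ h => ?_)
  refine .seq ((runs_push h rfl).mono fun _ h => ?_)
  refine .seq ((runs_push h rfl).mono fun _ h => ?_)
  refine .seq ((runs_push h rfl).mono fun _ h => ?_)
  refine .seq ((runs_push h rfl).mono fun _ h => ?_)
  refine .seq ((runs_push h rfl).mono fun _ h => ?_)
  refine .seq ((runs_push h rfl).mono fun _ h => ?_)
  refine (runs_push h rfl).mono fun m' h => ⟨h.1, fun i hi => ?_⟩
  rw [← List.getD_eq_getElem _ 0 hi]
  exact h.2 i hi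

/-- The kernelization algorithm. Register `1` holds the number of vertices, register `2` the number of
cops, register `3` the result of the easiness test, register `4` the budget, register `13` the number
of kept vertices, and register `17` the length of the output. Array `1` holds the positions of the
rows of the adjacency matrix, array `2` powers of two, array `3` a candidate for a vertex cover, array
`4` the kept vertices and array `5` the output. -/
def kernelize : Prog :=
  .seq setup <|
  .seq easyTest <|
  .cond (.reg 3) writeTrivialYes <|
  .seq listKept <|
  .seq makeOutput copyOutput

theorem runs_kernelize (I : Instance) :
    Runs (bitSize I.encode) kernelize (start I.encode) fun m => Output m I.kernel.encode := by
  refine .seq_frame (runs_setup I) fun m₁ hm₁ _ => ?_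
  refine .seq_frame (runs_easyTest hm₁) fun m₂ h₂ hf₂ => ?_
  have hm₂ := hm₁.frame hf₂ (by decide) (by decide) (by decide) (by decide)
  rw [kernel]
  refine .cond (fun he => ?_) fun he => ?_
  · rw [if_pos (h₂.1 he)]
    exact runs_writeTrivialYes
  · rw [if_neg (mt h₂.2 (not_not.2 he))]
    refine .seq_frame (runs_listKept hm₂) fun m₃ h₃ hf₃ => ?_
    have hm₃ := hm₂.frame hf₃ (by decide) (by decide) (by decide) (by decide)
    exact .seq ((runs_makeOutput ⟨hm₃, h₃⟩).mono fun m₄ h₄ =>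
      runs_copyOutput h₄ I.length_encode_reduce_le)

end Program

end CnR

theorem theorem8 :
    -- a kernelization algorithm
    (∃ F : CnR.Instance → CnR.Instance,
      RAM.PolyTimeComputable CnR.Instance.encode F ∧
      (∀ I : CnR.Instance, I.Yes ↔ (F I).Yes) ∧
      (∃ g : ℕ → ℕ, Computable g ∧ ∀ I : CnR.Instance, RAM.bitSize (F I).encode ≤ g I.vcn) ∧
      ∀ I : CnR.Instance, (F I).n ≤ max 1 (I.vcn + I.vcn * 2 ^ I.vcn)) ∧
    -- the reduction rule is safe
    (∀ (I : CnR.Instance) (U S K : Set (Fin I.n)),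
      I.graph.IsVertexCover U → S ⊆ U →
      I.k + 1 < (I.nbhdClass U S).ncard →
      K ⊆ I.nbhdClass U S → K.ncard = I.k + 1 →
      (I.keepOnly (I.nbhdClass U S) K).Connected ∧
      (I.Yes ↔ CnR.CopsWin (I.keepOnly (I.nbhdClass U S) K) I.cop I.robber)) := by
  refine ⟨⟨CnR.Instance.kernel, ?_, fun I => I.yes_iff_yes_kernel,
    ⟨CnR.kernelSizeBound, CnR.computable_kernelSizeBound, fun I => I.bitSize_kernel_le⟩,
    fun I => I.n_kernel_le⟩, fun I U S K _ _ _ hK hcard => I.keepOnly_safe hK hcard⟩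
  exact RAM.polyTimeComputable_of_runs CnR.Program.kernelize CnR.Program.runs_kernelize
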